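/- Notation. Write points of $\mathbb R^2$ as $(x,t)$, let $P=3t\,\partial_t+x\,\partial_x$, let $\|f\|_{H^{7/2}(\mathbb R^2)}=\|\langle D_{x,t}\rangle^{7/2}f\|_{L^2(\mathbb R^2)}$, and let $t^{1/3}$ be the real cube root. Let $a,b,c,\tilde a,\tilde b,\tilde c\in\mathbb R$, let $x_0\in\mathbb R$, $t_0\neq 0$ and $0<\varepsilon<|t_0|$, and put $I=(x_0-\varepsilon,x_0+\varepsilon)\times(t_0-\varepsilon,t_0+\varepsilon)$. Let $\psi\in C_0^\infty(\mathbb R^2)$ be real-valued with $\psi=1$ on $I$, and let $C,A_1,A_2>0$. **Proposition 4.3.** There are positive constants $c_1,A_3,A_4$, depending only on the data above, with the following property. Let $u,v$ be (real- or complex-valued) tempered distributions on $\mathbb R^2$ which on $I$ are locally square integrable functions and satisfy on $I$, in the sense of distributions, the system $$u_t+u_{xxx}+a\,uu_x+b\,vv_x+c\,(uv)_x=0,\qquad v_t+v_{xxx}+\tilde a\,uu_x+\tilde b\,vv_x+\tilde c\,(uv)_x=0,$$ where $uu_x=\tfrac12(u^2)_x$ and $vv_x=\tfrac12(v^2)_x$.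 Suppose that $$\|\psi P^ku\|_{H^{7/2}(\mathbb R^2)}\le C A_1^k (k!)^2,\qquad \|\psi P^kv\|_{H^{7/2}(\mathbb R^2)}\le C A_2^k (k!)^2,\qquad k=0,1,2,\dots$$ Then for all $k,l=0,1,2,\dots$ the distributions $\partial_x^lP^ku$ and $\partial_x^lP^kv$ are given on $I$ by functions that extend continuously to $\overline I$ (so that they have well-defined values at each time $t\in[t_0-\varepsilon,t_0+\varepsilon]$), and $$\sup_{t\in[t_0-\varepsilon,t_0+\varepsilon]}\|(t^{1/3}\partial_x)^lP^ku\|_{H^1(x_0-\varepsilon,x_0+\varepsilon)}\le c_1A_3^{k+l}[(k+l)!]^2,$$ $$\sup_{t\in[t_0-\varepsilon,t_0+\varepsilon]}\|(t^{1/3}\partial_x)^lP^kv\|_{H^1(x_0-\varepsilon,x_0+\varepsilon)}\le c_1A_4^{k+l}[(k+l)!]^2.$$ -/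

import Mathlib

open MeasureTheory TemperedDistribution
open scoped SchwartzMap LineDeriv ENNReal ContDiff Nat

noncomputable section

namespace KdVSystem

/-- The space-time plane `ℝ²`; a point `z` has space coordinate `x = z 0` and
time coordinate `t = z 1`. -/
abbrev Plane : Type := EuclideanSpace ℝ (Fin 2)

/-- The unit vector of the `x`-direction. -/
def ex : Plane := EuclideanSpace.single 0 1

/-- The unit vector of the `t`-direction. -/
def et : Plane := EuclideanSpace.single 1 1

/-- The generator of dilations `P = 3 t ∂ₜ + x ∂ₓ` acting on tempered distributions. -/
def P (u : 𝓢'(Plane, ℂ)) : 𝓢'(Plane, ℂ) :=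
  (3 : ℂ) • smulLeftCLM ℂ (fun z : Plane ↦ ((z 1 : ℝ) : ℂ)) (∂_{et} u)
    + smulLeftCLM ℂ (fun z : Plane ↦ ((z 0 : ℝ) : ℂ)) (∂_{ex} u)

/-- The powers `∂ₓ^l` acting on tempered distributions. -/
def dxPow (l : ℕ) (u : 𝓢'(Plane, ℂ)) : 𝓢'(Plane, ℂ) :=
  (fun w : 𝓢'(Plane, ℂ) ↦ ∂_{ex} w)^[l] u

/-- The product `ψ u` of a tempered distribution with a (smooth, compactly supported) cut-off
function. -/
def cutoff (ψ : Plane → ℝ) (u : 𝓢'(Plane, ℂ)) : 𝓢'(Plane, ℂ) :=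
  smulLeftCLM ℂ (fun z ↦ ((ψ z : ℝ) : ℂ)) u

/-- The norm of `H^s(ℝ²)`, i.e. the `L²` norm of `⟨D⟩^s f`; it is `∞` if `f ∉ H^s(ℝ²)`.
The infimum runs over at most one function `g ∈ L²`, the one which represents `⟨D⟩^s f`. -/
def sobolevNorm (s : ℝ) (f : 𝓢'(Plane, ℂ)) : ℝ≥0∞ :=
  ⨅ (g : Lp ℂ 2 (volume : Measure Plane))
    (_ : besselPotential Plane ℂ s f = (g : 𝓢'(Plane, ℂ))), ‖g‖ₑ

/-- `η` is a test function on the open set `U`. -/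
def IsTestOn (U : Set Plane) (η : 𝓢(Plane, ℂ)) : Prop :=
  HasCompactSupport (η : Plane → ℂ) ∧ tsupport (η : Plane → ℂ) ⊆ U

/-- On the open set `U`, the distribution `u` is given by the locally integrable function `f`. -/
def IsGivenBy (U : Set Plane) (u : 𝓢'(Plane, ℂ)) (f : Plane → ℂ) : Prop :=
  LocallyIntegrableOn f U ∧ ∀ η : 𝓢(Plane, ℂ), IsTestOn U η → u η = ∫ z, η z * f z

/-- The function `f` is locally square integrable on the open set `U`. -/
def LocallyL2On (U : Set Plane) (f : Plane → ℂ) : Prop :=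
  ∀ K : Set Plane, K ⊆ U → IsCompact K → MemLp f 2 (volume.restrict K)

/-- `∂ₜ w + ∂ₓ³ w + (a/2) ∂ₓ(f²) + (b/2) ∂ₓ(g²) + c ∂ₓ(f g) = 0` in the sense of
distributions on `U`. -/
def WeakEq (a b c : ℝ) (U : Set Plane) (w : 𝓢'(Plane, ℂ)) (f g : Plane → ℂ) : Prop :=
  ∀ η : 𝓢(Plane, ℂ), IsTestOn U η →
    (∂_{et} w + dxPow 3 w) η
      = ∫ z, ((a : ℂ) / 2 * f z ^ 2 + (b : ℂ) / 2 * g z ^ 2 + (c : ℂ) * (f z * g z)) *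
          (∂_{ex} η) z

/-- `(u, v)` is a distributional solution on the open set `U` of the coupled system
`uₜ + uₓₓₓ + a u uₓ + b v vₓ + c (u v)ₓ = 0`, `vₜ + vₓₓₓ + a' u uₓ + b' v vₓ + c' (u v)ₓ = 0`:
on `U` both are locally square integrable functions, so that the quadratic terms are defined,
and the equations, with `u uₓ = (u²)ₓ / 2` and `v vₓ = (v²)ₓ / 2`, hold against test functions. -/
def IsSolutionOn (a b c a' b' c' : ℝ) (U : Set Plane) (u v : 𝓢'(Plane, ℂ)) : Prop :=
  ∃ f g : Plane → ℂ, LocallyL2On U f ∧ LocallyL2On U g ∧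
    IsGivenBy U u f ∧ IsGivenBy U v g ∧
    WeakEq a b c U u f g ∧ WeakEq a' b' c' U v f g

/-- The open square `(x₀ - ε, x₀ + ε) × (t₀ - ε, t₀ + ε)`. -/
def square (x₀ t₀ ε : ℝ) : Set Plane :=
  {z | z 0 ∈ Set.Ioo (x₀ - ε) (x₀ + ε) ∧ z 1 ∈ Set.Ioo (t₀ - ε) (t₀ + ε)}

/-- The closed square `[x₀ - ε, x₀ + ε] × [t₀ - ε, t₀ + ε]`. -/
def closedSquare (x₀ t₀ ε : ℝ) : Set Plane :=
  {z | z 0 ∈ Set.Icc (x₀ - ε) (x₀ + ε) ∧ z 1 ∈ Set.Icc (t₀ - ε) (t₀ + ε)}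

/-- `g` is the weak derivative of `f` on the open set `J ⊆ ℝ`. -/
def HasWeakDerivOn (J : Set ℝ) (f g : ℝ → ℂ) : Prop :=
  LocallyIntegrableOn f J ∧ LocallyIntegrableOn g J ∧
    ∀ η : ℝ → ℝ, ContDiff ℝ ∞ η → HasCompactSupport η → tsupport η ⊆ J →
      ∫ x, ((deriv η x : ℝ) : ℂ) * f x = - ∫ x, ((η x : ℝ) : ℂ) * g x

/-- The norm `(‖f‖²_{L²(J)} + ‖f'‖²_{L²(J)})^{1/2}` of `H¹(J)`, with `f'` the weak derivative;
it is `∞` if `f ∉ H¹(J)`. All functions `g` in the infimum agree almost everywhere on `J`. -/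
def h1Norm (J : Set ℝ) (f : ℝ → ℂ) : ℝ≥0∞ :=
  ⨅ (g : ℝ → ℂ) (_ : HasWeakDerivOn J f g),
    (eLpNorm f 2 (volume.restrict J) ^ 2 + eLpNorm g 2 (volume.restrict J) ^ 2) ^ (1 / 2 : ℝ)

/-- The real cube root `t^{1/3}`, for `t` of either sign. -/
def cbrt (t : ℝ) : ℝ := Real.sign t * |t| ^ (1 / 3 : ℝ)

/-- The pointwise-in-time bound
`sup_{t ∈ [t₀ - ε, t₀ + ε]} ‖(t^{1/3} ∂ₓ)^l w‖_{H¹(x₀ - ε, x₀ + ε)} ≤ M`.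
For the values at a fixed time to be meaningful, `∂ₓ^l w` has to be given on the open square by a
function `V` which is continuous up to the boundary (and then `V` is unique on the closed square);
note that `(t^{1/3} ∂ₓ)^l = (t^{1/3})^l ∂ₓ^l`. -/
def PointwiseBound (x₀ t₀ ε : ℝ) (l : ℕ) (w : 𝓢'(Plane, ℂ)) (M : ℝ) : Prop :=
  ∃ V : Plane → ℂ, ContinuousOn V (closedSquare x₀ t₀ ε) ∧
    IsGivenBy (square x₀ t₀ ε) (dxPow l w) V ∧
    ⨆ t ∈ Set.Icc (t₀ - ε) (t₀ + ε),
      h1Norm (Set.Ioo (x₀ - ε) (x₀ + ε)) (fun x ↦ ((cbrt t : ℝ) : ℂ) ^ l * V !₂[x, t])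
        ≤ ENNReal.ofReal M

end KdVSystem

end

/-!
By the Sobolev embedding `H^s(ℝ²) ⊂ C²`, `s > 3`, all the `P^k w` are `C²` functions on the square,
and the hypothesis bounds their derivatives up to order two by the Gevrey weights `c A^k (k!)²`.
Since `P w = 3 t ∂ₜ w + x ∂ₓ w`, the equation `wₜ + wₓₓₓ = -∂ₓ B(w, w)`, to which `P` may be
applied any number of times, reads
`3 t ∂ₓ³ P^k w = -P^(k+1) w + x ∂ₓ P^k w - 3 t ∂ₓ (P + 2)^k B(w, w)`.
As `t` is bounded away from `0`, this gives the derivatives `∂ₓ^(l+3) P^k w` by recursion on `l`.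
One step trades three derivatives in `x` for one application of `P`; the loss, a factor of order
`(k + l)³`, is absorbed by the weights, which meanwhile rise by two orders. The Leibniz sums are
absorbed by `(n choose i) (i!)² (j!)² ≤ (n!)²` for `i + j = n`.
-/

namespace KdVSystem

section SobolevEmbedding

open FourierTransform Module

variable {E F : Type*} [NormedAddCommGroup E] [InnerProductSpace ℝ E] [FiniteDimensional ℝ E]
  [MeasurableSpace E] [BorelSpace E] [NormedAddCommGroup F]

lemma fourierInv_eq_fourierIntegral_neg_inner [NormedSpace ℂ F] (h : E → F) :
    𝓕⁻ h = VectorFourier.fourierIntegral Real.fourierChar volume (-innerₗ E) h := by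
  ext z
  simp [Real.fourierInv_eq, VectorFourier.fourierIntegral]

lemma integral_fourierInv_smul_eq_of_integrable [NormedSpace ℂ F] [CompleteSpace F] {θ : E → ℂ}
    {h : E → F} (hθ : Integrable θ) (hh : Integrable h) :
    ∫ ξ, 𝓕⁻ θ ξ • h ξ = ∫ z, θ z • 𝓕⁻ h z := by
  have flip_eq : ((-innerₗ E).flip : E →ₗ[ℝ] E →ₗ[ℝ] ℝ) = -innerₗ E := by
    ext x y
    simp [real_inner_comm]
  have := VectorFourier.integral_fourierIntegral_smul_eq_flip (L := -innerₗ E) (μ := volume)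
    (ν := volume) Real.continuous_fourierChar
    (by simp only [LinearMap.neg_apply, innerₗ_apply_apply]; fun_prop) hθ hh
  simpa only [flip_eq, ← fourierInv_eq_fourierIntegral_neg_inner] using this

lemma apply_eq_integral_fourierInv [NormedSpace ℂ F] [CompleteSpace F] {f : 𝓢'(E, F)} {h : E → F}
    (hh : Integrable h) (hf : ∀ η : 𝓢(E, ℂ), 𝓕 f η = ∫ ξ, η ξ • h ξ) (η : 𝓢(E, ℂ)) :
    f η = ∫ z, η z • 𝓕⁻ h z := by
  rw [← integral_fourierInv_smul_eq_of_integrable η.integrable hh, ← SchwartzMap.fourierInv_coe,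
    ← hf, TemperedDistribution.fourier_apply, fourier_fourierInv_eq]

lemma contDiff_fourierInv [NormedSpace ℂ F] {h : E → F} {N : ℕ∞}
    (hi : ∀ n : ℕ, n ≤ N → Integrable (fun ξ ↦ ‖ξ‖ ^ n * ‖h ξ‖)) : ContDiff ℝ N (𝓕⁻ h) := by
  have : 𝓕⁻ h = 𝓕 h ∘ Neg.neg := funext (Real.fourierInv_eq_fourier_neg h)
  exact this ▸ (Real.contDiff_fourier hi).comp contDiff_neg

lemma norm_iteratedFDeriv_fourierInv_le [NormedSpace ℂ F] {h : E → F} {N : ℕ∞}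
    (hm : AEStronglyMeasurable h volume)
    (hi : ∀ n : ℕ, n ≤ N → Integrable (fun ξ ↦ ‖ξ‖ ^ n * ‖h ξ‖)) {n : ℕ} (hn : n ≤ N) (z : E) :
    ‖iteratedFDeriv ℝ n (𝓕⁻ h) z‖ ≤ (2 * Real.pi) ^ n * ∫ ξ, ‖ξ‖ ^ n * ‖h ξ‖ := by
  have hcomp : 𝓕⁻ h = 𝓕 h ∘ LinearIsometryEquiv.neg ℝ :=
    funext (Real.fourierInv_eq_fourier_neg h)
  rw [hcomp, (LinearIsometryEquiv.neg ℝ).norm_iteratedFDeriv_comp_right,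
    Real.iteratedFDeriv_fourier hi hm hn, ← integral_const_mul]
  refine (VectorFourier.norm_fourierIntegral_le_integral_norm _ _ _ _ _).trans
    (integral_mono_of_nonneg (.of_forall fun _ ↦ norm_nonneg _) ((hi n hn).const_mul _)
      (.of_forall fun ξ ↦ ?_))
  refine (VectorFourier.norm_fourierPowSMulRight_le (innerSL ℝ) h ξ n).trans ?_
  rw [mul_assoc]
  refine mul_le_mul_of_nonneg_right (pow_le_pow_left₀ (by positivity) ?_ n) (by positivity)
  exact mul_le_of_le_one_right (by positivity) (norm_innerSL_le ℝ)

lemma memLp_two_one_add_norm_sq_rpow {r : ℝ} (hr : finrank ℝ E < 2 * r) :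
    MemLp (fun ξ : E ↦ (1 + ‖ξ‖ ^ 2) ^ (-r / 2)) 2 := by
  have hcont : Continuous (fun ξ : E ↦ (1 + ‖ξ‖ ^ 2) ^ (-r / 2)) :=
    .rpow_const (by fun_prop) fun ξ ↦ .inl (by positivity)
  rw [memLp_two_iff_integrable_sq hcont.aestronglyMeasurable]
  refine (integrable_rpow_neg_one_add_norm_sq hr).congr (.of_forall fun ξ ↦ ?_)
  simp only [← Real.rpow_mul_natCast (by positivity : 0 ≤ 1 + ‖ξ‖ ^ 2)]
  congr 1
  push_cast
  ring

lemma norm_pow_mul_one_add_norm_sq_rpow_le {G : Type*} [SeminormedAddGroup G] {n m : ℕ}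
    (hn : n ≤ m) (s : ℝ) (ξ : G) :
    ‖ξ‖ ^ n * (1 + ‖ξ‖ ^ 2) ^ (-s / 2) ≤ (1 + ‖ξ‖ ^ 2) ^ (-(s - m) / 2) := by
  have one_le : 1 ≤ 1 + ‖ξ‖ ^ 2 := by simp
  have hpow : ‖ξ‖ ^ n ≤ (1 + ‖ξ‖ ^ 2) ^ (m / 2 : ℝ) :=
    calc ‖ξ‖ ^ n = (‖ξ‖ ^ 2) ^ (n / 2 : ℝ) := by
          rw [← Real.rpow_natCast_mul (norm_nonneg ξ), Nat.cast_two, mul_div_cancel₀ _ two_ne_zero,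
            Real.rpow_natCast]
      _ ≤ (1 + ‖ξ‖ ^ 2) ^ (n / 2 : ℝ) := by gcongr; simp
      _ ≤ (1 + ‖ξ‖ ^ 2) ^ (m / 2 : ℝ) := by gcongr
  calc ‖ξ‖ ^ n * (1 + ‖ξ‖ ^ 2) ^ (-s / 2)
      ≤ (1 + ‖ξ‖ ^ 2) ^ (m / 2 : ℝ) * (1 + ‖ξ‖ ^ 2) ^ (-s / 2) := by gcongr
    _ = (1 + ‖ξ‖ ^ 2) ^ (-(s - m) / 2) := by
      rw [← Real.rpow_add (by positivity)]
      ring_nf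

lemma integral_norm_mul_norm_le {α : Type*} [MeasurableSpace α] {μ : Measure α} {θ : α → ℝ}
    (hθ : MemLp θ 2 μ) (u : Lp F 2 μ) :
    ∫ ξ, ‖θ ξ‖ * ‖u ξ‖ ∂μ ≤ (eLpNorm θ 2 μ).toReal * ‖u‖ := by
  have hu := Lp.memLp u
  have holder := integral_mul_norm_le_Lp_mul_Lq (f := fun ξ ↦ ‖θ ξ‖) (g := fun ξ ↦ ‖u ξ‖)
    Real.HolderConjugate.two_two (by simpa using hθ.norm) (by simpa using hu.norm)
  simp only [norm_norm] at holder
  refine holder.trans_eq ?_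
  rw [Lp.norm_def, hθ.eLpNorm_eq_integral_rpow_norm two_ne_zero ENNReal.ofNat_ne_top,
    hu.eLpNorm_eq_integral_rpow_norm two_ne_zero ENNReal.ofNat_ne_top,
    ENNReal.toReal_ofReal (by positivity), ENNReal.toReal_ofReal (by positivity)]
  simp

variable [InnerProductSpace ℂ F] [CompleteSpace F]

lemma fourier_apply_of_besselPotential_eq {s : ℝ} {f : 𝓢'(E, F)}
    {g : Lp F 2 (volume : Measure E)} (hfg : besselPotential E F s f = (g : 𝓢'(E, F)))
    (η : 𝓢(E, ℂ)) :
    𝓕 f η = ∫ ξ, η ξ • ((1 + ‖ξ‖ ^ 2) ^ (-s / 2) : ℝ) • (𝓕 g : Lp F 2 (volume : Measure E)) ξ := by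
  have hbessel : besselPotential E F (-s) (g : 𝓢'(E, F)) = f :=
    (besselPotential_neg_apply_eq_iff ..).2 hfg
  have hgrowth : (fun ξ : E ↦ (((1 + ‖ξ‖ ^ 2) ^ (-s / 2) : ℝ) : ℂ)).HasTemperateGrowth := by
    fun_prop
  rw [← hbessel, fourier_besselPotential_eq_smulLeftCLM_fourier_apply,
    Lp.fourier_toTemperedDistribution_eq, smulLeftCLM_apply_apply, Lp.toTemperedDistribution_apply]
  refine integral_congr_ae (.of_forall fun ξ ↦ ?_)
  simp only [SchwartzMap.smulLeftCLM_apply_apply hgrowth, smul_eq_mul, mul_comm _ (η ξ), mul_smul,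
    Complex.coe_smul]

theorem exists_contDiff_of_besselPotential_eq {m : ℕ} {s : ℝ} (hs : m + finrank ℝ E / 2 < s) :
    ∃ K : ℝ, 0 < K ∧ ∀ (f : 𝓢'(E, F)) (g : Lp F 2 (volume : Measure E)),
      besselPotential E F s f = (g : 𝓢'(E, F)) →
      ∃ h : E → F, ContDiff ℝ m h ∧ (∀ η : 𝓢(E, ℂ), f η = ∫ z, η z • h z) ∧
        ∀ n ≤ m, ∀ z, ‖iteratedFDeriv ℝ n h z‖ ≤ K * ‖g‖ := by
  set θ : E → ℝ := fun ξ ↦ (1 + ‖ξ‖ ^ 2) ^ (-(s - m) / 2)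
  have hθ : MemLp θ 2 := memLp_two_one_add_norm_sq_rpow (by linarith)
  set N : ℝ := (eLpNorm θ 2 volume).toReal
  have one_le : 1 ≤ 1 + 2 * Real.pi := by linarith [Real.pi_pos]
  refine ⟨(1 + 2 * Real.pi) ^ m * (1 + N), by positivity, fun f g hfg ↦ ?_⟩
  set u : Lp F 2 (volume : Measure E) := 𝓕 g
  set h : E → F := fun ξ ↦ ((1 + ‖ξ‖ ^ 2) ^ (-s / 2) : ℝ) • u ξ with hh
  have hmeas : AEStronglyMeasurable h volume :=
    (by fun_prop : Measurable fun ξ : E ↦ (1 + ‖ξ‖ ^ 2) ^ (-s / 2)).aestronglyMeasurable.smul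
      (Lp.aestronglyMeasurable u)
  have hle {n : ℕ} (hn : n ≤ m) (ξ : E) : ‖ξ‖ ^ n * ‖h ξ‖ ≤ ‖θ ξ‖ * ‖u ξ‖ := by
    rw [hh, norm_smul, ← mul_assoc, Real.norm_of_nonneg (by positivity)]
    gcongr
    exact (norm_pow_mul_one_add_norm_sq_rpow_le hn s ξ).trans (le_abs_self _)
  have hθu : Integrable (fun ξ ↦ ‖θ ξ‖ * ‖u ξ‖) := hθ.norm.integrable_mul (Lp.memLp u).norm
  have hmom (n : ℕ) (hn : (n : ℕ∞) ≤ m) : Integrable (fun ξ ↦ ‖ξ‖ ^ n * ‖h ξ‖) :=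
    hθu.mono' ((by fun_prop : Continuous fun ξ : E ↦ ‖ξ‖ ^ n).aestronglyMeasurable.mul hmeas.norm)
      (.of_forall fun ξ ↦ by
        rw [Real.norm_of_nonneg (by positivity)]; exact hle (mod_cast hn) ξ)
  have hint : Integrable h := (integrable_norm_iff hmeas).1 (by simpa using hmom 0 (by simp))
  refine ⟨𝓕⁻ h, contDiff_fourierInv hmom,
    apply_eq_integral_fourierInv hint (fourier_apply_of_besselPotential_eq hfg), fun n hn z ↦ ?_⟩
  calc ‖iteratedFDeriv ℝ n (𝓕⁻ h) z‖
      ≤ (2 * Real.pi) ^ n * ∫ ξ, ‖ξ‖ ^ n * ‖h ξ‖ :=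
        norm_iteratedFDeriv_fourierInv_le hmeas hmom (mod_cast hn) z
    _ ≤ (1 + 2 * Real.pi) ^ m * (N * ‖u‖) := by
        gcongr
        · exact (pow_le_pow_left₀ (by positivity) (by linarith) n).trans
            (pow_le_pow_right₀ one_le hn)
        · exact (integral_mono (hmom n (mod_cast hn)) hθu (hle hn)).trans
            (integral_norm_mul_norm_le hθ u)
    _ ≤ (1 + 2 * Real.pi) ^ m * (1 + N) * ‖g‖ := by
        rw [Lp.norm_fourier_eq, mul_assoc]
        gcongr
        simp

end SobolevEmbedding

theorem exists_contDiff_of_sobolevNorm_le {m : ℕ} {s : ℝ} (hs : m + 1 < s) :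
    ∃ K : ℝ, 0 < K ∧ ∀ (f : 𝓢'(Plane, ℂ)) (M : ℝ), 0 < M → sobolevNorm s f ≤ ENNReal.ofReal M →
      ∃ F : Plane → ℂ, ContDiff ℝ m F ∧ IsGivenBy Set.univ f F ∧
        ∀ n ≤ m, ∀ z, ‖iteratedFDeriv ℝ n F z‖ ≤ K * M := by
  obtain ⟨K, hK, embed⟩ := exists_contDiff_of_besselPotential_eq (E := Plane) (F := ℂ) (m := m)
    (s := s) (by simpa using hs)
  refine ⟨K * 2, by positivity, fun f M hM hf ↦ ?_⟩
  have hlt : sobolevNorm s f < ENNReal.ofReal (2 * M) :=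
    hf.trans_lt ((ENNReal.ofReal_lt_ofReal_iff (by positivity)).2 (by linarith))
  simp only [sobolevNorm, iInf_lt_iff] at hlt
  obtain ⟨g, hg, hgM⟩ := hlt
  obtain ⟨F, hF, hfF, hbound⟩ := embed f g hg
  refine ⟨F, hF, ⟨hF.continuous.locallyIntegrable.locallyIntegrableOn _, fun η _ ↦ hfF η⟩,
    fun n hn z ↦ (hbound n hn z).trans ?_⟩
  rw [← ofReal_norm, ENNReal.ofReal_lt_ofReal_iff (by positivity)] at hgM
  calc K * ‖g‖ ≤ K * (2 * M) := by gcongr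
    _ = K * 2 * M := by ring

section Leibniz

open LineDeriv

variable {E F : Type*} [NormedAddCommGroup E] [NormedSpace ℝ E] [AddCommGroup F] [Module ℂ F]
  [TopologicalSpace F] [IsTopologicalAddGroup F] [ContinuousConstSMul ℂ F]

lemma schwartz_lineDerivOp_comm (v w : E) (η : 𝓢(E, ℂ)) :
    (∂_{v} (∂_{w} η) : 𝓢(E, ℂ)) = ∂_{w} (∂_{v} η) := by
  ext z
  have hdiff : DifferentiableAt ℝ (fderiv ℝ η) z :=
    ((η.smooth 2).fderiv_right (m := 1) (by norm_num)).differentiable one_ne_zero z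
  have second_deriv (a b : E) :
      (∂_{a} (∂_{b} η) : 𝓢(E, ℂ)) z = fderiv ℝ (fderiv ℝ η) z a b := by
    rw [SchwartzMap.lineDerivOp_apply_eq_fderiv]
    have : ((∂_{b} η : 𝓢(E, ℂ)) : E → ℂ) = fun y ↦ fderiv ℝ η y b := rfl
    rw [this, fderiv_clm_apply hdiff (by fun_prop)]
    simp
  rw [second_deriv, second_deriv]
  exact (η.smooth 2).contDiffAt.isSymmSndFDerivAt (by simp) v w

lemma lineDerivOp_comm (v w : E) (u : 𝓢'(E, F)) :
    (∂_{v} (∂_{w} u) : 𝓢'(E, F)) = ∂_{w} (∂_{v} u) := by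
  ext η
  simp [lineDerivOp_neg, schwartz_lineDerivOp_comm v w]

lemma schwartz_lineDerivOp_smulLeftCLM {g g' : E → ℂ} {e : E} (hg : g.HasTemperateGrowth)
    (hg' : g'.HasTemperateGrowth) (hd : ∀ z, HasLineDerivAt ℝ g (g' z) z e) (η : 𝓢(E, ℂ)) :
    ∂_{e} (SchwartzMap.smulLeftCLM ℂ g η)
      = SchwartzMap.smulLeftCLM ℂ g' η + SchwartzMap.smulLeftCLM ℂ g (∂_{e} η) := by
  ext z
  have hη : HasLineDerivAt ℝ η ((∂_{e} η) z) z e :=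
    η.differentiableAt.hasFDerivAt.hasLineDerivAt e
  have hprod : HasLineDerivAt ℝ (SchwartzMap.smulLeftCLM ℂ g η)
      (g z * (∂_{e} η) z + g' z * η z) z e := by
    rw [SchwartzMap.smulLeftCLM_apply hg]
    simpa [HasLineDerivAt, add_comm] using HasDerivAt.fun_mul (hd z) hη
  rw [SchwartzMap.lineDerivOp_apply, hprod.lineDeriv, add_apply,
    SchwartzMap.smulLeftCLM_apply_apply hg, SchwartzMap.smulLeftCLM_apply_apply hg',
    smul_eq_mul, smul_eq_mul, add_comm]

lemma lineDerivOp_smulLeftCLM {g g' : E → ℂ} {e : E} (hg : g.HasTemperateGrowth)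
    (hg' : g'.HasTemperateGrowth) (hd : ∀ z, HasLineDerivAt ℝ g (g' z) z e) (u : 𝓢'(E, F)) :
    ∂_{e} (smulLeftCLM F g u) = smulLeftCLM F g' u + smulLeftCLM F g (∂_{e} u) := by
  ext η
  have := schwartz_lineDerivOp_smulLeftCLM hg hg' hd η
  simp [this]

end Leibniz

section Dilation

open LineDeriv

lemma hasTemperateGrowth_coord (i : Fin 2) :
    (fun z : Plane ↦ ((z i : ℝ) : ℂ)).HasTemperateGrowth :=
  (Complex.ofRealCLM.comp (EuclideanSpace.proj i : Plane →L[ℝ] ℝ)).hasTemperateGrowth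

lemma hasLineDerivAt_coord (i : Fin 2) (z e : Plane) :
    HasLineDerivAt ℝ (fun z : Plane ↦ ((z i : ℝ) : ℂ)) ((e i : ℝ) : ℂ) z e :=
  (Complex.ofRealCLM.comp (EuclideanSpace.proj i : Plane →L[ℝ] ℝ)).hasFDerivAt.hasLineDerivAt e

lemma lineDerivOp_coord_smul (i : Fin 2) (e : Plane) (u : 𝓢'(Plane, ℂ)) :
    ∂_{e} (smulLeftCLM ℂ (fun z : Plane ↦ ((z i : ℝ) : ℂ)) u)
      = ((e i : ℝ) : ℂ) • u + smulLeftCLM ℂ (fun z : Plane ↦ ((z i : ℝ) : ℂ)) (∂_{e} u) := by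
  rw [lineDerivOp_smulLeftCLM (hasTemperateGrowth_coord i) (.const _)
    (fun z ↦ hasLineDerivAt_coord i z e), smulLeftCLM_const]

@[simp] lemma ex_apply_zero : ex 0 = 1 := by simp [ex]

@[simp] lemma ex_apply_one : ex 1 = 0 := by simp [ex]

@[simp] lemma et_apply_zero : et 0 = 0 := by simp [et]

@[simp] lemma et_apply_one : et 1 = 1 := by simp [et]

lemma lineDerivOp_ex_P (u : 𝓢'(Plane, ℂ)) : ∂_{ex} (P u) = P (∂_{ex} u) + ∂_{ex} u := by
  simp only [P, lineDerivOp_add, lineDerivOp_smul, lineDerivOp_coord_smul, lineDerivOp_comm ex et,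
    ex_apply_zero, ex_apply_one, Complex.ofReal_zero, Complex.ofReal_one]
  module

lemma lineDerivOp_et_P (u : 𝓢'(Plane, ℂ)) :
    ∂_{et} (P u) = P (∂_{et} u) + (3 : ℂ) • ∂_{et} u := by
  simp only [P, lineDerivOp_add, lineDerivOp_smul, lineDerivOp_coord_smul, lineDerivOp_comm et ex,
    et_apply_zero, et_apply_one, Complex.ofReal_zero, Complex.ofReal_one]
  module

lemma P_add (u v : 𝓢'(Plane, ℂ)) : P (u + v) = P u + P v := by
  simp only [P, lineDerivOp_add, map_add, smul_add]
  abel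

lemma dxPow_succ (l : ℕ) (u : 𝓢'(Plane, ℂ)) : dxPow (l + 1) u = ∂_{ex} (dxPow l u) :=
  Function.iterate_succ_apply' _ _ _

lemma dxPow_P (l : ℕ) (u : 𝓢'(Plane, ℂ)) :
    dxPow l (P u) = P (dxPow l u) + (l : ℂ) • dxPow l u := by
  induction l with
  | zero =>
    simp only [dxPow, Function.iterate_zero_apply, Nat.cast_zero]
    module
  | succ l ih =>
    simp only [dxPow_succ, ih, lineDerivOp_add, lineDerivOp_smul, lineDerivOp_ex_P]
    push_cast
    module

/-- The linear part `∂ₜ + ∂ₓ³` of the equations. -/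
noncomputable def airy (u : 𝓢'(Plane, ℂ)) : 𝓢'(Plane, ℂ) :=
  ∂_{et} u + dxPow 3 u

lemma airy_P (u : 𝓢'(Plane, ℂ)) : airy (P u) = P (airy u) + (3 : ℂ) • airy u := by
  simp only [airy, lineDerivOp_et_P, dxPow_P, P_add]
  push_cast
  module

end Dilation

section GivenBy

open LineDeriv

lemma integrable_smul_of_tsupport_subset {X E 𝕜 : Type*} [TopologicalSpace X] [T2Space X]
    [MeasurableSpace X] [OpensMeasurableSpace X] {μ : Measure X} [NormedAddCommGroup E]
    [NormedRing 𝕜] [SecondCountableTopologyEither X 𝕜] [Module 𝕜 E] [IsBoundedSMul 𝕜 E]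
    {U : Set X} {θ : X → 𝕜} {f : X → E} (hθ : Continuous θ) (hθc : HasCompactSupport θ)
    (hθU : tsupport θ ⊆ U) (hf : LocallyIntegrableOn f U μ) :
    Integrable (fun x ↦ θ x • f x) μ := by
  have hint : IntegrableOn (fun x ↦ θ x • f x) (tsupport θ) μ :=
    (hf.integrableOn_compact_subset hθU hθc).continuousOn_smul hθ.continuousOn hθc
  exact (integrableOn_iff_integrable_of_support_subset
    ((Function.support_smul_subset_left θ f).trans (subset_tsupport θ))).1 hint

variable {U : Set Plane} {η : 𝓢(Plane, ℂ)} {u v : 𝓢'(Plane, ℂ)} {f g : Plane → ℂ}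

lemma isOpen_square (x₀ t₀ ε : ℝ) : IsOpen (square x₀ t₀ ε) :=
  (isOpen_Ioo.preimage (by fun_prop : Continuous fun z : Plane ↦ z 0)).inter
    (isOpen_Ioo.preimage (by fun_prop : Continuous fun z : Plane ↦ z 1))

lemma IsTestOn.of_tsupport_subset {θ : 𝓢(Plane, ℂ)} (hη : IsTestOn U η)
    (h : tsupport θ ⊆ tsupport η) : IsTestOn U θ :=
  ⟨hη.1.of_isClosed_subset (isClosed_tsupport _) h, h.trans hη.2⟩

lemma IsTestOn.lineDeriv (hη : IsTestOn U η) (e : Plane) : IsTestOn U (∂_{e} η) :=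
  hη.of_tsupport_subset (SchwartzMap.tsupport_lineDerivOp_subset e η)

lemma IsTestOn.smulLeft (hη : IsTestOn U η) (m : Plane → ℂ) :
    IsTestOn U (SchwartzMap.smulLeftCLM ℂ m η) :=
  hη.of_tsupport_subset ((SchwartzMap.tsupport_smulLeftCLM_subset m η).trans Set.inter_subset_left)

lemma IsTestOn.apply_eq_zero (hη : IsTestOn U η) {z : Plane} (hz : z ∉ U) : η z = 0 :=
  image_eq_zero_of_notMem_tsupport fun h ↦ hz (hη.2 h)

lemma IsTestOn.integrable_mul (hη : IsTestOn U η) (hf : LocallyIntegrableOn f U) :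
    Integrable (fun z ↦ η z * f z) :=
  integrable_smul_of_tsupport_subset η.continuous hη.1 hη.2 hf

lemma IsTestOn.integral_congr (hη : IsTestOn U η) (h : Set.EqOn f g U) :
    ∫ z, η z * f z = ∫ z, η z * g z := by
  refine integral_congr_ae (.of_forall fun z ↦ ?_)
  by_cases hz : z ∈ U
  · simp only [h hz]
  · simp only [hη.apply_eq_zero hz, zero_mul]

lemma IsTestOn.integral_lineDeriv_mul (hη : IsTestOn U η) (hU : IsOpen U) {f' : Plane → ℂ}
    {e : Plane} (hf : ContinuousOn f U) (hf' : ContinuousOn f' U)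
    (hd : ∀ z ∈ U, HasLineDerivAt ℝ f (f' z) z e) :
    ∫ z, (∂_{e} η) z * f z = -∫ z, η z * f' z := by
  have hloc := hf.locallyIntegrableOn hU.measurableSet (μ := volume)
  have := integral_bilinear_hasLineDerivAt_right_eq_neg_left_of_integrable (μ := volume)
    (f := (η : Plane → ℂ)) (f' := fun z ↦ (∂_{e} η) z) (B := ContinuousLinearMap.mul ℝ ℂ)
    ((hη.lineDeriv e).integrable_mul hloc)
    (hη.integrable_mul (hf'.locallyIntegrableOn hU.measurableSet)) (hη.integrable_mul hloc)
    (fun z _ ↦ η.differentiableAt.hasFDerivAt.hasLineDerivAt e) (fun z hz ↦ hd z (hη.2 hz))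
  simp only [ContinuousLinearMap.mul_apply'] at this
  rw [this, neg_neg]

lemma IsGivenBy.mono {O : Set Plane} (h : IsGivenBy U u f) (hO : O ⊆ U) : IsGivenBy O u f :=
  ⟨h.1.mono_set hO, fun η hη ↦ h.2 η ⟨hη.1, hη.2.trans hO⟩⟩

lemma IsGivenBy.congr (h : IsGivenBy U u f) (hg : ContinuousOn g U) (hU : IsOpen U)
    (hfg : Set.EqOn f g U) : IsGivenBy U u g :=
  ⟨hg.locallyIntegrableOn hU.measurableSet, fun η hη ↦ (h.2 η hη).trans (hη.integral_congr hfg)⟩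

lemma IsGivenBy.add (hu : IsGivenBy U u f) (hv : IsGivenBy U v g) :
    IsGivenBy U (u + v) (fun z ↦ f z + g z) := by
  refine ⟨hu.1.add hv.1, fun η hη ↦ ?_⟩
  simp only [add_apply, hu.2 η hη, hv.2 η hη, mul_add]
  exact (integral_add (hη.integrable_mul hu.1) (hη.integrable_mul hv.1)).symm

lemma IsGivenBy.const_smul (hu : IsGivenBy U u f) (c : ℂ) :
    IsGivenBy U (c • u) (fun z ↦ c * f z) := by
  refine ⟨hu.1.smul c, fun η hη ↦ ?_⟩
  simp only [mul_left_comm _ c, integral_const_mul]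
  rw [smul_apply, hu.2 η hη, smul_eq_mul]

lemma IsGivenBy.sub (hu : IsGivenBy U u f) (hv : IsGivenBy U v g) :
    IsGivenBy U (u - v) (fun z ↦ f z - g z) := by
  refine ⟨hu.1.sub hv.1, fun η hη ↦ ?_⟩
  simp only [sub_apply, hu.2 η hη, hv.2 η hη, mul_sub]
  exact (integral_sub (hη.integrable_mul hu.1) (hη.integrable_mul hv.1)).symm

lemma IsGivenBy.smulLeftCLM {m : Plane → ℂ} (hu : IsGivenBy U u f) (hU : IsOpen U)
    (hm : m.HasTemperateGrowth) : IsGivenBy U (smulLeftCLM ℂ m u) (fun z ↦ m z * f z) := by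
  refine ⟨hu.1.continuousOn_mul hm.1.continuous.continuousOn hU.isLocallyClosed, fun η hη ↦ ?_⟩
  rw [smulLeftCLM_apply_apply, hu.2 _ (hη.smulLeft m)]
  simp only [SchwartzMap.smulLeftCLM_apply_apply hm, smul_eq_mul, mul_comm (m _), mul_assoc]

lemma IsGivenBy.lineDeriv {f' : Plane → ℂ} {e : Plane} (hu : IsGivenBy U u f) (hU : IsOpen U)
    (hf : ContinuousOn f U) (hf' : ContinuousOn f' U)
    (hd : ∀ z ∈ U, HasLineDerivAt ℝ f (f' z) z e) : IsGivenBy U (∂_{e} u) f' := by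
  refine ⟨hf'.locallyIntegrableOn hU.measurableSet, fun η hη ↦ ?_⟩
  rw [lineDerivOp_apply_apply, map_neg, hu.2 _ (hη.lineDeriv e),
    hη.integral_lineDeriv_mul hU hf hf' hd, neg_neg]

lemma IsGivenBy.ae_eq (hf : IsGivenBy U u f) (hg : IsGivenBy U u g) (hU : IsOpen U) :
    ∀ᵐ z, z ∈ U → f z = g z := by
  have hzero : ∀ᵐ z, z ∈ U → (f - g) z = 0 := by
    refine hU.ae_eq_zero_of_integral_contDiff_smul_eq_zero (hf.1.sub hg.1) fun θ hθ hθc hθU ↦ ?_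
    have hc : HasCompactSupport (fun z ↦ ((θ z : ℝ) : ℂ)) :=
      hθc.comp_left (g := fun r : ℝ ↦ (r : ℂ)) Complex.ofReal_zero
    set η : 𝓢(Plane, ℂ) := hc.toSchwartzMap (Complex.ofRealCLM.contDiff.comp hθ)
    have hsupp : tsupport (fun z ↦ ((θ z : ℝ) : ℂ)) ⊆ tsupport θ :=
      tsupport_comp_subset (g := fun r : ℝ ↦ (r : ℂ)) Complex.ofReal_zero θ
    have hη : IsTestOn U η := ⟨hc, hsupp.trans hθU⟩
    have hsmul (z : Plane) : θ z • (f - g) z = η z * f z - η z * g z := by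
      rw [Pi.sub_apply, Complex.real_smul, mul_sub]
      rfl
    simp only [hsmul]
    rw [integral_sub (hη.integrable_mul hf.1) (hη.integrable_mul hg.1), ← hf.2 η hη, hg.2 η hη,
      sub_self]
  filter_upwards [hzero] with z hz hzU
  exact sub_eq_zero.1 (hz hzU)

lemma IsGivenBy.eqOn (hf : IsGivenBy U u f) (hg : IsGivenBy U u g) (hU : IsOpen U)
    (hfc : ContinuousOn f U) (hgc : ContinuousOn g U) : Set.EqOn f g U :=
  Measure.eqOn_open_of_ae_eq ((ae_restrict_iff' hU.measurableSet).2 (hf.ae_eq hg hU)) hU hfc hgc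

lemma IsGivenBy.of_cutoff {ψ : Plane → ℝ} (h : IsGivenBy U (cutoff ψ u) f)
    (hψ : (fun z ↦ ((ψ z : ℝ) : ℂ)).HasTemperateGrowth) (hψ1 : ∀ z ∈ U, ψ z = 1) :
    IsGivenBy U u f := by
  refine ⟨h.1, fun η hη ↦ ?_⟩
  have hψη : SchwartzMap.smulLeftCLM ℂ (fun z ↦ ((ψ z : ℝ) : ℂ)) η = η := by
    ext z
    rw [SchwartzMap.smulLeftCLM_apply_apply hψ, smul_eq_mul]
    by_cases hz : z ∈ U
    · rw [hψ1 z hz, Complex.ofReal_one, one_mul]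
    · rw [hη.apply_eq_zero hz, mul_zero]
  rw [← h.2 η hη, cutoff, smulLeftCLM_apply_apply, hψη]

end GivenBy

section ClassicalDilation

open LineDeriv

variable {F : Type*} [NormedAddCommGroup F] [NormedSpace ℝ F]

/-- The classical counterpart `3 t ∂ₜ + x ∂ₓ` of `P`, acting on differentiable functions. -/
noncomputable def dilation (G : Plane → F) (z : Plane) : F :=
  (3 * z 1) • fderiv ℝ G z et + z 0 • fderiv ℝ G z ex

lemma contDiff_fderiv_apply {G : Plane → F} {m n : WithTop ℕ∞} (hG : ContDiff ℝ n G)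
    (hmn : m + 1 ≤ n) (e : Plane) : ContDiff ℝ m (fun z ↦ fderiv ℝ G z e) :=
  (hG.fderiv_right hmn).clm_apply contDiff_const

lemma contDiff_dilation {G : Plane → F} {m n : WithTop ℕ∞} (hG : ContDiff ℝ n G)
    (hmn : m + 1 ≤ n) : ContDiff ℝ m (dilation G) := by
  have hderiv := contDiff_fderiv_apply hG hmn
  have hcoord (i : Fin 2) : ContDiff ℝ m (fun z : Plane ↦ z i) := by fun_prop
  exact ((contDiff_const.mul (hcoord 1)).smul (hderiv et)).add ((hcoord 0).smul (hderiv ex))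

lemma fderiv_dilation_ex {G : Plane → F} (hG : ContDiff ℝ 2 G) (z : Plane) :
    fderiv ℝ (dilation G) z ex = dilation (fun y ↦ fderiv ℝ G y ex) z + fderiv ℝ G z ex := by
  have hdiff : DifferentiableAt ℝ (fderiv ℝ G) z :=
    (hG.fderiv_right (m := 1) (by norm_num)).differentiable one_ne_zero z
  have hx : HasFDerivAt (fun y : Plane ↦ y 0) (EuclideanSpace.proj 0 : Plane →L[ℝ] ℝ) z :=
    (EuclideanSpace.proj 0 : Plane →L[ℝ] ℝ).hasFDerivAt
  have ht : HasFDerivAt (fun y : Plane ↦ y 1) (EuclideanSpace.proj 1 : Plane →L[ℝ] ℝ) z :=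
    (EuclideanSpace.proj 1 : Plane →L[ℝ] ℝ).hasFDerivAt
  have hderiv (e : Plane) : HasFDerivAt (fun y ↦ fderiv ℝ G y e)
      ((fderiv ℝ (fderiv ℝ G) z).flip e) z := by
    simpa using hdiff.hasFDerivAt.clm_apply (hasFDerivAt_const e z)
  have hdil := ((ht.const_mul 3).fun_smul (hderiv et)).fun_add (hx.fun_smul (hderiv ex))
  have hsymm : fderiv ℝ (fderiv ℝ G) z ex et = fderiv ℝ (fderiv ℝ G) z et ex :=
    hG.contDiffAt.isSymmSndFDerivAt (by simp) ex et
  have hfun : dilation G = fun y ↦ (3 * y 1) • fderiv ℝ G y et + y 0 • fderiv ℝ G y ex := rfl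
  rw [hfun, hdil.fderiv, dilation, (hderiv ex).fderiv]
  simp only [add_apply, smul_apply, ContinuousLinearMap.flip_apply, hsymm,
    ContinuousLinearMap.smulRight_apply, PiLp.proj_apply, ex_apply_one, smul_eq_mul, mul_zero,
    zero_smul, add_zero, ex_apply_zero, one_smul]
  abel

lemma IsGivenBy.lineDeriv_of_contDiff {U : Set Plane} {u : 𝓢'(Plane, ℂ)} {G : Plane → ℂ}
    (hu : IsGivenBy U u G) (hU : IsOpen U) (hG : ContDiff ℝ 1 G) (e : Plane) :
    IsGivenBy U (∂_{e} u) (fun z ↦ fderiv ℝ G z e) :=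
  hu.lineDeriv hU hG.continuous.continuousOn
    (contDiff_fderiv_apply hG (m := 0) (by simp) e).continuous.continuousOn
    fun z _ ↦ (hG.differentiable one_ne_zero z).hasFDerivAt.hasLineDerivAt e

lemma IsGivenBy.P {U : Set Plane} {u : 𝓢'(Plane, ℂ)} {G : Plane → ℂ} (hu : IsGivenBy U u G)
    (hU : IsOpen U) (hG : ContDiff ℝ 1 G) : IsGivenBy U (P u) (dilation G) := by
  have hderiv := hu.lineDeriv_of_contDiff hU hG
  have := (((hderiv et).smulLeftCLM hU (hasTemperateGrowth_coord 1)).const_smul 3).add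
    ((hderiv ex).smulLeftCLM hU (hasTemperateGrowth_coord 0))
  have hdil : dilation G = fun z ↦
      3 * (((z 1 : ℝ) : ℂ) * fderiv ℝ G z et) + ((z 0 : ℝ) : ℂ) * fderiv ℝ G z ex := by
    ext z
    simp [dilation, mul_assoc]
  rw [hdil]
  exact this

/-- Applying `P` to `wₜ + wₓₓₓ = -∂ₓ M` replaces `M` by `(P + 2) M`: the equation is homogeneous of
degree `3` while `∂ₓ` lowers degrees by one. -/
lemma IsGivenBy.airy_P {U : Set Plane} {w : 𝓢'(Plane, ℂ)} {M : Plane → ℂ} (hU : IsOpen U)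
    (hM : ContDiff ℝ 2 M) (hw : IsGivenBy U (airy w) (fun z ↦ -fderiv ℝ M z ex)) :
    IsGivenBy U (airy (KdVSystem.P w))
      (fun z ↦ -(fderiv ℝ (dilation M) z ex + 2 * fderiv ℝ M z ex)) := by
  have hMx : ContDiff ℝ 1 (fun z ↦ -fderiv ℝ M z ex) :=
    (contDiff_fderiv_apply hM (by norm_num) ex).neg
  have := (hw.P hU hMx).add (hw.const_smul 3)
  rw [← KdVSystem.airy_P] at this
  convert this using 2 with z
  have hneg : dilation (fun y ↦ -fderiv ℝ M y ex) z = -dilation (fun y ↦ fderiv ℝ M y ex) z := by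
    simp only [dilation, fderiv_fun_neg, neg_apply, smul_neg, Complex.real_smul, Complex.ofReal_mul,
      Complex.ofReal_ofNat, neg_add_rev]
    ring
  rw [fderiv_dilation_ex hM, hneg]
  ring

end ClassicalDilation

section WeakDerivative

open Filter Topology Convolution LineDeriv

lemma hasDerivAt_of_tendsto_of_tendsto_prod {ι F : Type*} [NormedAddCommGroup F] [NormedSpace ℝ F]
    {l : Filter ι} [l.NeBot] {s : Set ℝ} (hs : IsOpen s) {f f' : ι → ℝ → F} {g g' : ℝ → F}
    (hg' : ContinuousOn g' s) (hf : ∀ᶠ n in l, ∀ x ∈ s, HasDerivAt (f n) (f' n x) x)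
    (hfg : ∀ x ∈ s, Tendsto (fun n ↦ f n x) l (𝓝 (g x)))
    (hfg' : ∀ x ∈ s, Tendsto (fun p : ι × ℝ ↦ f' p.1 p.2) (l ×ˢ 𝓝 x) (𝓝 (g' x))) {x : ℝ}
    (hx : x ∈ s) : HasDerivAt g (g' x) x := by
  refine hasDerivAt_of_tendstoLocallyUniformlyOn hs ?_ hf hfg hx
  rw [tendstoLocallyUniformlyOn_iff_forall_tendsto]
  intro y hy
  rw [hs.nhdsWithin_eq hy]
  exact (((hg'.continuousAt (hs.mem_nhds hy)).tendsto.comp tendsto_snd).prodMk_nhds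
    (hfg' y hy)).mono_right (nhds_le_uniformity _)

lemma hasLineDerivAt_add_smul_iff {E F : Type*} [AddCommGroup E] [Module ℝ E]
    [NormedAddCommGroup F] [NormedSpace ℝ F] {G : E → F} {c : F} {z e : E} {s : ℝ} :
    HasLineDerivAt ℝ G c (z + s • e) e ↔ HasDerivAt (fun r : ℝ ↦ G (z + r • e)) c s := by
  have hshift (r : ℝ) : z + s • e + r • e = z + (s + r) • e := by module
  simp only [HasLineDerivAt, hshift]
  exact ⟨fun h ↦ by
      simpa using HasDerivAt.comp_const_add (f := fun r ↦ G (z + (s + r) • e)) (-s) s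
        (by simpa using h),
    fun h ↦ HasDerivAt.comp_const_add (f := fun r ↦ G (z + r • e)) s 0 (by simpa using h)⟩

variable {U : Set Plane}

lemma exists_isTestOn_reflect {f : Plane → ℝ} (hf : ContDiff ℝ ∞ f) (hfc : HasCompactSupport f)
    {y : Plane} (hfU : ∀ t, y - t ∈ tsupport f → t ∈ U) :
    ∃ η : 𝓢(Plane, ℂ), IsTestOn U η ∧ (∀ t, η t = (f (y - t) : ℝ)) ∧
      ∀ e t, (∂_{e} η : 𝓢(Plane, ℂ)) t = -((fderiv ℝ f (y - t) e : ℝ) : ℂ) := by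
  have hc : HasCompactSupport (fun t ↦ ((f (y - t) : ℝ) : ℂ)) :=
    (hfc.comp_homeomorph (Homeomorph.subLeft y)).comp_left (g := fun r : ℝ ↦ (r : ℂ))
      Complex.ofReal_zero
  have hderiv (t : Plane) : HasFDerivAt (fun t ↦ ((f (y - t) : ℝ) : ℂ))
      (Complex.ofRealCLM ∘L (fderiv ℝ f (y - t) ∘L (-.id ℝ Plane))) t :=
    Complex.ofRealCLM.hasFDerivAt.comp t <|
      (hf.differentiable (by simp) (y - t)).hasFDerivAt.comp t ((hasFDerivAt_id t).const_sub y)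
  refine ⟨hc.toSchwartzMap (Complex.ofRealCLM.contDiff.comp
    (hf.comp (contDiff_const.sub contDiff_id))), ⟨hc, ?_⟩, fun t ↦ rfl, fun e t ↦ ?_⟩
  · refine (closure_minimal (fun t ht ↦ ?_)
      ((isClosed_tsupport f).preimage (by fun_prop : Continuous fun t ↦ y - t))).trans hfU
    exact subset_tsupport f fun h ↦ ht (Complex.ofReal_eq_zero.2 h)
  · rw [SchwartzMap.lineDerivOp_apply_eq_fderiv]
    change fderiv ℝ (fun t ↦ ((f (y - t) : ℝ) : ℂ)) t e = _
    simp [(hderiv t).fderiv]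

lemma hasLineDerivAt_convolution_bump {G H : Plane → ℂ} (hG : LocallyIntegrable G) {e : Plane}
    (h : ∀ η : 𝓢(Plane, ℂ), IsTestOn U η → ∫ z, (∂_{e} η) z * G z = -∫ z, η z * H z)
    (b : ContDiffBump (0 : Plane)) {y : Plane} (hy : Metric.closedBall y b.rOut ⊆ U) :
    HasLineDerivAt ℝ (b.normed volume ⋆[ContinuousLinearMap.lsmul ℝ ℝ, volume] G)
      ((b.normed volume ⋆[ContinuousLinearMap.lsmul ℝ ℝ, volume] H) y) y e := by
  have hsmooth : ContDiff ℝ 1 (b.normed volume) := b.contDiff_normed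
  have hfderiv := b.hasCompactSupport_normed.hasFDerivAt_convolution_left
    (ContinuousLinearMap.lsmul ℝ ℝ) hsmooth hG (μ := volume) y
  have hconv := (b.hasCompactSupport_normed.fderiv ℝ).convolutionExists_left
    ((ContinuousLinearMap.lsmul ℝ ℝ : ℝ →L[ℝ] ℂ →L[ℝ] ℂ).precompL Plane)
    (hsmooth.continuous_fderiv one_ne_zero) hG (μ := volume) y
  have hsupp (t : Plane) (ht : y - t ∈ tsupport (b.normed volume)) : t ∈ U := by
    rw [b.tsupport_normed_eq, mem_closedBall_zero_iff] at ht
    exact hy (by rwa [Metric.mem_closedBall, dist_comm, dist_eq_norm])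
  obtain ⟨η, hη, hηb, hdη⟩ :=
    exists_isTestOn_reflect b.contDiff_normed b.hasCompactSupport_normed hsupp
  suffices hval : (b.normed volume ⋆[ContinuousLinearMap.lsmul ℝ ℝ, volume] H) y
      = (fderiv ℝ (b.normed volume) ⋆[(ContinuousLinearMap.lsmul ℝ ℝ :
        ℝ →L[ℝ] ℂ →L[ℝ] ℂ).precompL Plane, volume] G) y e from
    hval ▸ hfderiv.hasLineDerivAt e
  rw [convolution_eq_swap, convolution_eq_swap,
    ContinuousLinearMap.integral_apply hconv.integrable_swap]
  simpa [hηb, hdη, integral_neg] using (h η hη).symm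

/-- Mollification turns the weak derivative into a classical one, and both converge. -/
lemma hasLineDerivAt_of_weak (hU : IsOpen U) {G H : Plane → ℂ} (hG : LocallyIntegrable G)
    (hH : LocallyIntegrable H) (hGU : ContinuousOn G U) (hHU : ContinuousOn H U) {e : Plane}
    (h : ∀ η : 𝓢(Plane, ℂ), IsTestOn U η → ∫ z, (∂_{e} η) z * G z = -∫ z, η z * H z)
    {z : Plane} (hz : z ∈ U) : HasLineDerivAt ℝ G (H z) z e := by
  obtain ⟨r, hr, hrU⟩ := Metric.isOpen_iff.1 hU z hz
  have hline : Continuous fun s : ℝ ↦ z + s • e := by fun_prop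
  set s : Set ℝ := (fun s : ℝ ↦ z + s • e) ⁻¹' Metric.ball z (r / 2)
  have hs (x : ℝ) (hx : x ∈ s) : U ∈ 𝓝 (z + x • e) :=
    hU.mem_nhds (hrU (Metric.ball_subset_ball (half_le_self hr.le) hx))
  let b (n : ℕ) : ContDiffBump (0 : Plane) :=
    ⟨1 / ((n : ℝ) + 2), 1 / ((n : ℝ) + 1), by positivity,
      one_div_lt_one_div_of_lt (by positivity) (by linarith)⟩
  have hb : Tendsto (fun n ↦ (b n).rOut) atTop (𝓝 0) := tendsto_one_div_add_atTop_nhds_zero_nat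
  suffices HasDerivAt (fun s : ℝ ↦ G (z + s • e)) (H (z + (0 : ℝ) • e)) 0 by
    simpa [HasLineDerivAt] using this
  refine hasDerivAt_of_tendsto_of_tendsto_prod (l := atTop) (s := s)
    (g' := fun s : ℝ ↦ H (z + s • e))
    (f := fun n s ↦ ((b n).normed volume ⋆[ContinuousLinearMap.lsmul ℝ ℝ, volume] G) (z + s • e))
    (f' := fun n s ↦ ((b n).normed volume ⋆[ContinuousLinearMap.lsmul ℝ ℝ, volume] H) (z + s • e))
    (Metric.isOpen_ball.preimage hline)
    (hHU.comp hline.continuousOn fun x hx ↦ mem_of_mem_nhds (hs x hx)) ?_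
    (fun x hx ↦ ?_) (fun x hx ↦ ?_) (by simpa [s] using hr)
  · filter_upwards [hb.eventually (gt_mem_nhds (half_pos hr))] with n hn x hx
    refine hasLineDerivAt_add_smul_iff.1 (hasLineDerivAt_convolution_bump hG h (b n) ?_)
    exact (Metric.closedBall_subset_ball' (by linarith [Metric.mem_ball.1 hx])).trans hrU
  · exact ContDiffBump.convolution_tendsto_right hb (.of_forall fun _ ↦ hG.aestronglyMeasurable)
      ((hGU.continuousAt (hs x hx)).tendsto.comp tendsto_snd) tendsto_const_nhds
  · have hb_fst : Tendsto (fun p : ℕ × ℝ ↦ (b p.1).rOut) (atTop ×ˢ 𝓝 x) (𝓝 0) :=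
      hb.comp tendsto_fst
    exact ContDiffBump.convolution_tendsto_right (g := fun _ ↦ H) hb_fst
      (.of_forall fun _ ↦ hH.aestronglyMeasurable)
      ((hHU.continuousAt (hs x hx)).tendsto.comp tendsto_snd)
      (hline.continuousAt.tendsto.comp tendsto_snd)

lemma IsGivenBy.hasLineDerivAt {u : 𝓢'(Plane, ℂ)} {G H : Plane → ℂ} {e : Plane}
    (hU : IsOpen U) (hu : IsGivenBy U u G) (hdu : IsGivenBy U (∂_{e} u) H)
    (hG : ContinuousOn G U) (hH : ContinuousOn H U) {z : Plane} (hz : z ∈ U) :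
    HasLineDerivAt ℝ G (H z) z e := by
  obtain ⟨r, hr, hrU⟩ := Metric.nhds_basis_closedBall.mem_iff.1 (hU.mem_nhds hz)
  set K := Metric.closedBall z r
  have hball : Metric.ball z r ⊆ K := Metric.ball_subset_closedBall
  have hint {f : Plane → ℂ} (hf : ContinuousOn f U) : LocallyIntegrable (K.indicator f) :=
    (((hf.mono hrU).integrableOn_compact (isCompact_closedBall z r)).integrable_indicator
      measurableSet_closedBall).locallyIntegrable
  have heq (f : Plane → ℂ) : Set.EqOn f (K.indicator f) (Metric.ball z r) := fun y hy ↦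
    (Set.indicator_of_mem (hball hy) f).symm
  have hcont {f : Plane → ℂ} (hf : ContinuousOn f U) :
      ContinuousOn (K.indicator f) (Metric.ball z r) :=
    (hf.mono (hball.trans hrU)).congr (heq f).symm
  have hu_ball := (hu.mono (hball.trans hrU)).congr (hcont hG) Metric.isOpen_ball (heq G)
  have hdu_ball := (hdu.mono (hball.trans hrU)).congr (hcont hH) Metric.isOpen_ball (heq H)
  have hderiv : HasLineDerivAt ℝ (K.indicator G) (K.indicator H z) z e :=
    hasLineDerivAt_of_weak Metric.isOpen_ball (hint hG) (hint hH) (hcont hG) (hcont hH)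
      (fun η hη ↦ by
        rw [← hu_ball.2 _ (hη.lineDeriv e), ← hdu_ball.2 _ hη, lineDerivOp_apply_apply, map_neg,
          neg_neg])
      (Metric.mem_ball_self hr)
  rw [Set.indicator_of_mem (hball (Metric.mem_ball_self hr))] at hderiv
  exact hderiv.congr_of_eventuallyEq ((heq G).eventuallyEq_of_mem (Metric.ball_mem_nhds z hr))

end WeakDerivative

section Flux

open Finset.HasAntidiagonal (antidiagonal)

section BinomSum

variable {G : Type*} [AddCommMonoid G]

/-- The binomial sum `∑ (n choose i) f i j` over `i + j = n`. -/
def binomSum (n : ℕ) (f : ℕ → ℕ → G) : G :=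
  ∑ p ∈ antidiagonal n, n.choose p.1 • f p.1 p.2

lemma binomSum_zero (f : ℕ → ℕ → G) : binomSum 0 f = f 0 0 := by simp [binomSum]

lemma binomSum_add (n : ℕ) (f g : ℕ → ℕ → G) :
    binomSum n (fun i j ↦ f i j + g i j) = binomSum n f + binomSum n g := by
  simp only [binomSum, smul_add, Finset.sum_add_distrib]

lemma binomSum_nsmul (n c : ℕ) (f : ℕ → ℕ → G) :
    binomSum n (fun i j ↦ c • f i j) = c • binomSum n f := by
  simp only [binomSum, smul_comm _ c, Finset.smul_sum]

lemma binomSum_succ (n : ℕ) (f : ℕ → ℕ → G) :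
    binomSum (n + 1) f = binomSum n (fun i j ↦ f (i + 1) j + f i (j + 1)) := by
  rw [binomSum_add, binomSum, Finset.sum_antidiagonal_choose_succ_nsmul (M := G) f n, add_comm]
  congr 1
  refine Finset.sum_congr rfl fun p hp ↦ ?_
  rw [Nat.choose_symm_of_eq_add (Finset.HasAntidiagonal.mem_antidiagonal.1 hp).symm]

lemma continuousOn_binomSum {X : Type*} [TopologicalSpace X] [TopologicalSpace G] [ContinuousAdd G]
    {n : ℕ} {f : ℕ → ℕ → X → G} {S : Set X} (h : ∀ i j, i ≤ n → j ≤ n → ContinuousOn (f i j) S) :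
    ContinuousOn (fun z ↦ binomSum n (fun i j ↦ f i j z)) S :=
  continuousOn_finsetSum _ fun p hp ↦ (h p.1 p.2 (Finset.HasAntidiagonal.antidiagonal.fst_le hp)
    (Finset.HasAntidiagonal.antidiagonal.snd_le hp)).fun_const_smul _

/-- The value at `0` of `(S + 2)^n V`, with `S` the shift of sequences. -/
def shiftAddTwo (V : ℕ → G) (n : ℕ) : G :=
  binomSum n (fun i j ↦ 2 ^ j • V i)

lemma shiftAddTwo_succ (V : ℕ → G) (n : ℕ) :
    shiftAddTwo V (n + 1) = shiftAddTwo (fun i ↦ V (i + 1)) n + 2 • shiftAddTwo V n := by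
  simp only [shiftAddTwo, binomSum_succ, binomSum_add, pow_succ', mul_smul, binomSum_nsmul]

end BinomSum

variable {E F : Type*} [NormedAddCommGroup E] [NormedSpace ℝ E] [NormedAddCommGroup F]
  [NormedSpace ℝ F] (B : F →L[ℝ] F →L[ℝ] F)

/-- The Leibniz expansion of `(P + 2)^k (B(V, W))` in terms of the sequences of the `P^i V` and
`P^j W`. -/
noncomputable def flux (V W : ℕ → F) (k : ℕ) : F :=
  binomSum k (fun i j ↦ B (V i) (shiftAddTwo W j))

variable {B}

lemma flux_zero (V W : ℕ → F) : flux B V W 0 = B (V 0) (W 0) := by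
  simp [flux, shiftAddTwo, binomSum_zero]

lemma flux_succ (V W : ℕ → F) (k : ℕ) :
    flux B V W (k + 1) =
      flux B (fun i ↦ V (i + 1)) W k + flux B V (fun i ↦ W (i + 1)) k + 2 • flux B V W k := by
  simp only [flux, binomSum_succ, shiftAddTwo_succ, map_add, map_nsmul, binomSum_add,
    binomSum_nsmul, add_assoc]

lemma continuousOn_flux {X : Type*} [TopologicalSpace X] {V W : ℕ → X → F} {S : Set X}
    (hV : ∀ i, ContinuousOn (V i) S) (hW : ∀ i, ContinuousOn (W i) S) (k : ℕ) :
    ContinuousOn (fun z ↦ flux B (fun i ↦ V i z) (fun i ↦ W i z) k) S :=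
  continuousOn_binomSum fun i _ _ _ ↦ (B.continuous.comp_continuousOn (hV i)).clm_apply
    (continuousOn_binomSum fun m _ _ _ ↦ (hW m).fun_const_smul _)

section Derivatives

variable {s : ℝ} {n : ℕ}

lemma hasDerivAt_binomSum {f : ℕ → ℕ → ℝ → F} {f' : ℕ → ℕ → F}
    (h : ∀ i j, i ≤ n → j ≤ n → HasDerivAt (f i j) (f' i j) s) :
    HasDerivAt (fun r ↦ binomSum n (fun i j ↦ f i j r)) (binomSum n f') s :=
  HasDerivAt.fun_sum fun p hp ↦ (h p.1 p.2 (Finset.HasAntidiagonal.antidiagonal.fst_le hp)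
    (Finset.HasAntidiagonal.antidiagonal.snd_le hp)).fun_const_smul _

lemma hasDerivAt_flux {V W : ℕ → ℝ → F} {V' W' : ℕ → F}
    (hV : ∀ i, HasDerivAt (V i) (V' i) s) (hW : ∀ i, HasDerivAt (W i) (W' i) s) (k : ℕ) :
    HasDerivAt (fun r ↦ flux B (fun i ↦ V i r) (fun i ↦ W i r) k)
      (flux B V' (fun i ↦ W i s) k + flux B (fun i ↦ V i s) W' k) s := by
  rw [add_comm]
  simp only [flux, ← binomSum_add]
  exact hasDerivAt_binomSum fun i j _ _ ↦ B.hasDerivAt_of_bilinear (fun _ ↦ hV i) fun _ ↦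
    (hasDerivAt_binomSum fun m _ _ _ ↦ (hW m).fun_const_smul _)

lemma contDiff_binomSum {m : WithTop ℕ∞} {f : ℕ → ℕ → E → F} (h : ∀ i j, ContDiff ℝ m (f i j)) :
    ContDiff ℝ m (fun z ↦ binomSum n (fun i j ↦ f i j z)) :=
  ContDiff.sum fun p _ ↦ (h p.1 p.2).const_smul _

lemma contDiff_flux {m : WithTop ℕ∞} {V W : ℕ → E → F} (hV : ∀ i, ContDiff ℝ m (V i))
    (hW : ∀ i, ContDiff ℝ m (W i)) (k : ℕ) :
    ContDiff ℝ m (fun z ↦ flux B (fun i ↦ V i z) (fun i ↦ W i z) k) :=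
  contDiff_binomSum fun i _ ↦ (B.contDiff.comp (hV i)).clm_apply
    (contDiff_binomSum fun j _ ↦ (hW j).const_smul _)

lemma fderiv_flux_apply {V W : ℕ → E → F} (hV : ∀ i, ContDiff ℝ 1 (V i))
    (hW : ∀ i, ContDiff ℝ 1 (W i)) (k : ℕ) (z e : E) :
    fderiv ℝ (fun y ↦ flux B (fun i ↦ V i y) (fun i ↦ W i y) k) z e =
      flux B (fun i ↦ fderiv ℝ (V i) z e) (fun i ↦ W i z) k
        + flux B (fun i ↦ V i z) (fun i ↦ fderiv ℝ (W i) z e) k := by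
  have hline {G : E → F} (hG : ContDiff ℝ 1 G) : HasDerivAt (fun r : ℝ ↦ G (z + r • e))
      (fderiv ℝ G z e) 0 :=
    (hG.differentiable one_ne_zero z).hasFDerivAt.hasLineDerivAt e
  simpa using (hline (contDiff_flux hV hW k)).unique
    (hasDerivAt_flux (B := B) (fun i ↦ hline (hV i)) (fun i ↦ hline (hW i)) k)

end Derivatives

lemma dilation_flux_add_two_nsmul {V : ℕ → Plane → F} (hV : ∀ i, ContDiff ℝ 1 (V i)) (k : ℕ)
    {z : Plane} (hz : ∀ i, V (i + 1) z = dilation (V i) z) :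
    dilation (fun y ↦ flux B (fun i ↦ V i y) (fun i ↦ V i y) k) z
        + 2 • flux B (fun i ↦ V i z) (fun i ↦ V i z) k
      = flux B (fun i ↦ V i z) (fun i ↦ V i z) (k + 1) := by
  have dilation_eq (G : Plane → F) :
      dilation G z = fderiv ℝ G z ((3 * z 1) • et + z 0 • ex) := by
    simp [dilation]
  rw [dilation_eq, fderiv_flux_apply hV hV, flux_succ]
  simp only [← dilation_eq, hz]

end Flux

section Jets

open Finset.HasAntidiagonal (antidiagonal)

variable {F : Type*} [NormedAddCommGroup F] [NormedSpace ℝ F] {B : F →L[ℝ] F →L[ℝ] F}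
  {V : ℕ → Plane → F}

/-- The functions which represent `∂ₓ^l P^k w` if the `V k` represent `P^k w` and
`wₜ + wₓₓₓ + ∂ₓ (B(w, w)) = 0`. For `l ≥ 3` they are obtained by applying `∂ₓ^(l - 3)` to
`3 t ∂ₓ³ P^k w = -P^(k+1) w + x ∂ₓ P^k w - 3 t ∂ₓ (P + 2)^k B(w, w)`, which trades three
derivatives in `x` for one application of `P`. -/
noncomputable def jet (B : F →L[ℝ] F →L[ℝ] F) (V : ℕ → Plane → F) : ℕ → ℕ → Plane → F
  | 0, k, z => V k z
  | 1, k, z => fderiv ℝ (V k) z ex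
  | 2, k, z => fderiv ℝ (fun y ↦ fderiv ℝ (V k) y ex) z ex
  | l + 3, k, z =>
    -(3 * z 1)⁻¹ • (jet B V l (k + 1) z - z 0 • jet B V (l + 1) k z - (l : ℝ) • jet B V l k z)
      - ∑ p ∈ (antidiagonal (l + 1)).attach, (l + 1).choose p.1.1 •
          flux B (fun i ↦ jet B V p.1.1 i z) (fun i ↦ jet B V p.1.2 i z) k
  termination_by l => l
  decreasing_by
    all_goals first
      | omega
      | (have := Finset.HasAntidiagonal.antidiagonal.fst_le p.2; omega)
      | (have := Finset.HasAntidiagonal.antidiagonal.snd_le p.2; omega)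

lemma jet_zero (k : ℕ) : jet B V 0 k = V k := by
  ext z
  rw [jet]

lemma jet_one (k : ℕ) : jet B V 1 k = fun z ↦ fderiv ℝ (V k) z ex := by
  ext z
  rw [jet]

lemma jet_two (k : ℕ) : jet B V 2 k = fun z ↦ fderiv ℝ (fun y ↦ fderiv ℝ (V k) y ex) z ex := by
  ext z
  rw [jet]

lemma jet_add_three (l k : ℕ) (z : Plane) :
    jet B V (l + 3) k z =
      -(3 * z 1)⁻¹ • (jet B V l (k + 1) z - z 0 • jet B V (l + 1) k z - (l : ℝ) • jet B V l k z)
        - binomSum (l + 1) (fun i j ↦ flux B (jet B V i · z) (jet B V j · z) k) := by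
  rw [jet, binomSum]
  congr 1
  exact Finset.sum_attach (antidiagonal (l + 1)) fun p ↦
    (l + 1).choose p.1 • flux B (jet B V p.1 · z) (jet B V p.2 · z) k

lemma continuousOn_jet (hV : ∀ k, ContDiff ℝ 2 (V k)) (l k : ℕ) :
    ContinuousOn (jet B V l k) {z | z 1 ≠ 0} := by
  induction l using Nat.strong_induction_on generalizing k with
  | _ l ih =>
    have hVx := contDiff_fderiv_apply (hV k) (m := 1) (by norm_num) ex
    match l with
    | 0 => exact jet_zero (B := B) (V := V) k ▸ (hV k).continuous.continuousOn
    | 1 => exact jet_one (B := B) (V := V) k ▸ hVx.continuous.continuousOn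
    | 2 =>
      exact jet_two (B := B) (V := V) k ▸
        (contDiff_fderiv_apply hVx (m := 0) (by simp) ex).continuous.continuousOn
    | l + 3 =>
      have hlow (i : ℕ) (hi : i ≤ l + 1) (m : ℕ) : ContinuousOn (jet B V i m) {z | z 1 ≠ 0} :=
        ih i (by omega) m
      simp only [funext (jet_add_three l k)]
      refine .sub (.smul ?_ (((hlow l (by omega) _).sub ?_).sub ?_)) ?_
      · exact ((by fun_prop : Continuous fun z : Plane ↦ 3 * z 1).continuousOn.inv₀
          fun z hz ↦ mul_ne_zero three_ne_zero hz).neg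
      · exact (by fun_prop : Continuous fun z : Plane ↦ z 0).continuousOn.smul (hlow _ le_rfl k)
      · exact (hlow l (by omega) k).const_smul _
      · exact continuousOn_binomSum fun i j hi hj ↦ continuousOn_flux (hlow i hi) (hlow j hj) k

lemma hasLineDerivAt_jet_add_three {l k : ℕ} {z : Plane}
    (h : ∀ i ≤ l + 1, ∀ m, HasLineDerivAt ℝ (jet B V i m) (jet B V (i + 1) m z) z ex) :
    HasLineDerivAt ℝ (jet B V (l + 3) k) (jet B V (l + 4) k z) z ex := by
  have hx : HasDerivAt (fun r : ℝ ↦ z 0 + r) 1 0 := (hasDerivAt_id (0 : ℝ)).const_add _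
  have hbinom : HasDerivAt (fun r : ℝ ↦ binomSum (l + 1) fun i j ↦
      flux B (jet B V i · (z + r • ex)) (jet B V j · (z + r • ex)) k) _ 0 :=
    hasDerivAt_binomSum fun i j hi hj ↦ hasDerivAt_flux (h i hi) (h j hj) k
  have hlin := ((((h l (by omega) (k + 1)).fun_sub (hx.fun_smul (h (l + 1) le_rfl k))).fun_sub
    ((h l (by omega) k).fun_const_smul (l : ℝ))).fun_const_smul (-(3 * z 1)⁻¹)).fun_sub hbinom
  have hfun : (fun r : ℝ ↦ jet B V (l + 3) k (z + r • ex)) = fun r : ℝ ↦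
      -(3 * z 1)⁻¹ • (jet B V l (k + 1) (z + r • ex) - (z 0 + r) • jet B V (l + 1) k (z + r • ex)
          - (l : ℝ) • jet B V l k (z + r • ex))
        - binomSum (l + 1) (fun i j ↦
            flux B (jet B V i · (z + r • ex)) (jet B V j · (z + r • ex)) k) := by
    ext r
    simp [jet_add_three]
  rw [HasLineDerivAt, hfun]
  convert! hlin using 1
  rw [jet_add_three (l + 1), binomSum_succ]
  simp only [zero_smul, add_zero, Nat.cast_add, Nat.cast_one, one_smul]
  module

end Jets

section SolutionFamily

open Topology

variable {ι : Type*} [Fintype ι] {B : (ι → ℂ) →L[ℝ] (ι → ℂ) →L[ℝ] (ι → ℂ)} {U : Set Plane}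
  {w : ι → 𝓢'(Plane, ℂ)} {V : ℕ → Plane → ι → ℂ}

/-- The `C²` functions `V k` represent `P^k w` on `U`, for a solution `w` of
`wₜ + wₓₓₓ + ∂ₓ (B(w, w)) = 0` on `U`. -/
structure IsSolutionFamily (U : Set Plane) (B : (ι → ℂ) →L[ℝ] (ι → ℂ) →L[ℝ] (ι → ℂ))
    (w : ι → 𝓢'(Plane, ℂ)) (V : ℕ → Plane → ι → ℂ) : Prop where
  contDiff : ∀ k, ContDiff ℝ 2 (V k)
  isGivenBy : ∀ k α, IsGivenBy U (P^[k] (w α)) (V k · α)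
  airy_zero : ∀ α, IsGivenBy U (airy (w α)) fun z ↦ -fderiv ℝ (fun y ↦ B (V 0 y) (V 0 y)) z ex α

lemma fderiv_eval {G : Plane → ι → ℂ} (hG : ContDiff ℝ 1 G) (z e : Plane) (α : ι) :
    fderiv ℝ (G · α) z e = fderiv ℝ G z e α := by
  rw [fderiv_apply (hG.differentiable one_ne_zero z)]
  rfl

lemma dilation_eval {G : Plane → ι → ℂ} (hG : ContDiff ℝ 1 G) (z : Plane) (α : ι) :
    dilation (G · α) z = dilation G z α := by
  simp [dilation, fderiv_eval hG]

namespace IsSolutionFamily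

variable (h : IsSolutionFamily U B w V)
include h

lemma contDiff_one (k : ℕ) : ContDiff ℝ 1 (V k) := (h.contDiff k).of_le (by norm_num)

lemma eqOn_dilation (hU : IsOpen U) (k : ℕ) : Set.EqOn (V (k + 1)) (dilation (V k)) U := by
  intro z hz
  ext α
  have hVα : ContDiff ℝ 1 (V k · α) := contDiff_pi.1 (h.contDiff_one k) α
  have hP : IsGivenBy U (P^[k + 1] (w α)) (dilation (V k · α)) := by
    rw [Function.iterate_succ_apply']
    exact (h.isGivenBy k α).P hU hVα
  rw [← dilation_eval (h.contDiff_one k)]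
  exact (h.isGivenBy (k + 1) α).eqOn hP hU
    (contDiff_pi.1 (h.contDiff (k + 1)) α).continuous.continuousOn
    (contDiff_dilation hVα (m := 0) (by simp)).continuous.continuousOn hz

lemma contDiff_flux (k : ℕ) : ContDiff ℝ 2 (fun z ↦ flux B (V · z) (V · z) k) :=
  KdVSystem.contDiff_flux h.contDiff h.contDiff k

lemma airy_iterate (hU : IsOpen U) (k : ℕ) (α : ι) :
    IsGivenBy U (airy (P^[k] (w α))) fun z ↦
      -fderiv ℝ (fun y ↦ flux B (V · y) (V · y) k) z ex α := by
  have hflux (k : ℕ) := h.contDiff_flux k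
  induction k with
  | zero =>
    simp only [flux_zero]
    exact h.airy_zero α
  | succ k ih =>
    have hflux_one (k : ℕ) : ContDiff ℝ 1 (fun z ↦ flux B (V · z) (V · z) k) :=
      (hflux k).of_le (by norm_num)
    simp only [← fderiv_eval (hflux_one k)] at ih
    have hP := IsGivenBy.airy_P hU (contDiff_pi.1 (hflux k) α) ih
    rw [← Function.iterate_succ_apply' P] at hP
    refine hP.congr
      (contDiff_pi.1 (contDiff_fderiv_apply (hflux (k + 1)) (m := 1) (by norm_num) ex).neg
        α).continuous.continuousOn hU fun z hz ↦ ?_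
    have hsucc : (fun y ↦ flux B (V · y) (V · y) (k + 1) α) =ᶠ[𝓝 z] fun y ↦
        dilation (fun y ↦ flux B (V · y) (V · y) k α) y + 2 * flux B (V · y) (V · y) k α := by
      filter_upwards [hU.mem_nhds hz] with y hy
      rw [← dilation_flux_add_two_nsmul h.contDiff_one k fun i ↦ h.eqOn_dilation hU i hy]
      simp [dilation_eval (hflux_one k)]
    have hdil := (contDiff_dilation (contDiff_pi.1 (hflux k) α) (m := 1)
      (by norm_num)).differentiable one_ne_zero z
    have hdiff := (contDiff_pi.1 (hflux_one k) α).differentiable one_ne_zero z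
    dsimp only
    rw [← fderiv_eval (hflux_one (k + 1)), hsucc.fderiv_eq,
      fderiv_fun_add hdil (hdiff.const_mul 2), fderiv_const_mul hdiff]
    simp

lemma jet_three (hU : IsOpen U) (k : ℕ) {z : Plane} (hz : z ∈ U) (hzt : z 1 ≠ 0) :
    jet B V 3 k z = -fderiv ℝ (V k) z et - fderiv ℝ (fun y ↦ flux B (V · y) (V · y) k) z ex := by
  rw [fderiv_flux_apply h.contDiff_one h.contDiff_one, jet_add_three, binomSum_succ, binomSum_zero]
  simp only [jet_zero, zero_add, jet_one, h.eqOn_dilation hU k hz, dilation, Nat.cast_zero,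
    zero_smul, sub_zero, add_sub_cancel_right, smul_smul]
  have hinv : -(3 * z 1)⁻¹ * (3 * z 1) = -1 := by field_simp
  rw [hinv, neg_one_smul]

lemma hasLineDerivAt_jet_zero (k : ℕ) (z : Plane) :
    HasLineDerivAt ℝ (jet B V 0 k) (jet B V 1 k z) z ex := by
  rw [jet_zero, jet_one]
  exact ((h.contDiff k).differentiable two_ne_zero z).hasFDerivAt.hasLineDerivAt ex

lemma hasLineDerivAt_jet_one (k : ℕ) (z : Plane) :
    HasLineDerivAt ℝ (jet B V 1 k) (jet B V 2 k z) z ex := by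
  rw [jet_one, jet_two]
  exact ((contDiff_fderiv_apply (h.contDiff k) (m := 1) (by norm_num) ex).differentiable
    one_ne_zero z).hasFDerivAt.hasLineDerivAt ex

lemma isGivenBy_jet_zero (k : ℕ) (α : ι) :
    IsGivenBy U (dxPow 0 (P^[k] (w α))) (jet B V 0 k · α) := by
  rw [jet_zero]
  exact h.isGivenBy k α

lemma continuousOn_jet_eval (hUt : ∀ z ∈ U, z 1 ≠ 0) (l k : ℕ) (α : ι) :
    ContinuousOn (jet B V l k · α) U :=
  continuousOn_pi.1 ((continuousOn_jet h.contDiff l k).mono hUt) α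

lemma isGivenBy_jet_succ (hU : IsOpen U) (hUt : ∀ z ∈ U, z 1 ≠ 0) {l k : ℕ} {α : ι}
    (hl : IsGivenBy U (dxPow l (P^[k] (w α))) (jet B V l k · α))
    (hd : ∀ z ∈ U, HasLineDerivAt ℝ (jet B V l k) (jet B V (l + 1) k z) z ex) :
    IsGivenBy U (dxPow (l + 1) (P^[k] (w α))) (jet B V (l + 1) k · α) := by
  rw [dxPow_succ]
  exact hl.lineDeriv hU (h.continuousOn_jet_eval hUt l k α)
    (h.continuousOn_jet_eval hUt (l + 1) k α) fun z hz ↦ hasDerivAt_pi.1 (hd z hz) α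

lemma hasLineDerivAt_jet_two (hU : IsOpen U) (hUt : ∀ z ∈ U, z 1 ≠ 0) (k : ℕ) {z : Plane}
    (hz : z ∈ U) : HasLineDerivAt ℝ (jet B V 2 k) (jet B V 3 k z) z ex := by
  refine hasDerivAt_pi.2 fun α ↦ ?_
  have h_two : IsGivenBy U (dxPow 2 (P^[k] (w α))) (jet B V 2 k · α) :=
    h.isGivenBy_jet_succ hU hUt
      (h.isGivenBy_jet_succ hU hUt (h.isGivenBy_jet_zero k α) fun z _ ↦
        h.hasLineDerivAt_jet_zero k z) fun z _ ↦ h.hasLineDerivAt_jet_one k z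
  have h_et : IsGivenBy U (∂_{et} (P^[k] (w α))) (fun z ↦ fderiv ℝ (V k · α) z et) :=
    (h.isGivenBy k α).lineDeriv_of_contDiff hU (contDiff_pi.1 (h.contDiff_one k) α) et
  have h_three : IsGivenBy U (∂_{ex} (dxPow 2 (P^[k] (w α)))) (jet B V 3 k · α) := by
    have hairy := (h.airy_iterate hU k α).sub h_et
    rw [airy, add_sub_cancel_left, dxPow_succ] at hairy
    refine hairy.congr (h.continuousOn_jet_eval hUt 3 k α) hU fun z hz ↦ ?_
    simp only [h.jet_three hU k hz (hUt z hz), fderiv_eval (h.contDiff_one k), Pi.sub_apply,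
      Pi.neg_apply]
    ring
  exact h_two.hasLineDerivAt hU h_three (h.continuousOn_jet_eval hUt 2 k α)
    (h.continuousOn_jet_eval hUt 3 k α) hz

lemma hasLineDerivAt_jet (hU : IsOpen U) (hUt : ∀ z ∈ U, z 1 ≠ 0) (l k : ℕ) {z : Plane}
    (hz : z ∈ U) : HasLineDerivAt ℝ (jet B V l k) (jet B V (l + 1) k z) z ex := by
  induction l using Nat.strong_induction_on generalizing k with
  | _ l ih =>
    match l with
    | 0 => exact h.hasLineDerivAt_jet_zero k z
    | 1 => exact h.hasLineDerivAt_jet_one k z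
    | 2 => exact h.hasLineDerivAt_jet_two hU hUt k hz
    | l + 3 => exact hasLineDerivAt_jet_add_three fun i hi m ↦ ih i (by omega) m

lemma isGivenBy_jet (hU : IsOpen U) (hUt : ∀ z ∈ U, z 1 ≠ 0) (l k : ℕ) (α : ι) :
    IsGivenBy U (dxPow l (P^[k] (w α))) (jet B V l k · α) := by
  induction l with
  | zero => exact h.isGivenBy_jet_zero k α
  | succ l ih => exact h.isGivenBy_jet_succ hU hUt ih fun z hz ↦ h.hasLineDerivAt_jet hU hUt l k hz

end IsSolutionFamily

end SolutionFamily

section Gevrey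

lemma choose_mul_choose_le (i j p r : ℕ) :
    (i + j).choose i * (p + r).choose p ≤ (i + j + (p + r)).choose (i + p) := by
  rw [Nat.add_choose_eq (i + j) (p + r) (i + p)]
  exact Finset.single_le_sum (f := fun q : ℕ × ℕ ↦ (i + j).choose q.1 * (p + r).choose q.2)
    (fun _ _ ↦ Nat.zero_le _) (a := (i, p)) (Finset.HasAntidiagonal.mem_antidiagonal.2 rfl)

lemma choose_mul_choose_mul_factorial_le (i j p r : ℕ) :
    (i + j).choose i * (p + r).choose p * ((i + p)! * (j + r)!) ≤ (i + j + (p + r))! := by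
  refine (Nat.mul_le_mul_right _ (choose_mul_choose_le i j p r)).trans_eq ?_
  rw [add_add_add_comm, ← mul_assoc, Nat.choose_symm_add,
    Nat.add_choose_mul_factorial_mul_factorial]

/-- The weights `c Aⁿ (n!)²` of the Gevrey class of order `2`. -/
noncomputable def gevrey (c A : ℝ) (n : ℕ) : ℝ := c * A ^ n * (n ! : ℝ) ^ 2

variable {c d A : ℝ}

lemma gevrey_nonneg (hc : 0 ≤ c) (hA : 0 ≤ A) (n : ℕ) : 0 ≤ gevrey c A n := by
  rw [gevrey]
  positivity

lemma gevrey_succ (c A : ℝ) (n : ℕ) :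
    gevrey c A (n + 1) = A * ((n : ℝ) + 1) ^ 2 * gevrey c A n := by
  rw [gevrey, gevrey, Nat.factorial_succ]
  push_cast
  ring

lemma gevrey_le_succ (hc : 0 ≤ c) (hA : 1 ≤ A) (n : ℕ) : gevrey c A n ≤ gevrey c A (n + 1) := by
  rw [gevrey_succ]
  exact le_mul_of_one_le_left (gevrey_nonneg hc (by linarith) n)
    (one_le_mul_of_one_le_of_one_le hA (one_le_pow₀ (by simp)))

lemma mul_pow_three_mul_gevrey_le (hc : 0 ≤ c) (hA : 1 ≤ A) (n : ℕ) :
    A * (((n : ℝ) + 1) ^ 3 * gevrey c A n) ≤ gevrey c A (n + 2) := by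
  have hpow : ((n : ℝ) + 1) ^ 3 ≤ A * (((n : ℝ) + 1) ^ 2 * ((n : ℝ) + 2) ^ 2) := by
    have hn : (n : ℝ) + 1 ≤ ((n : ℝ) + 2) ^ 2 := by nlinarith [(Nat.cast_nonneg n : (0 : ℝ) ≤ n)]
    calc ((n : ℝ) + 1) ^ 3 = 1 * (((n : ℝ) + 1) ^ 2 * ((n : ℝ) + 1)) := by ring
      _ ≤ A * (((n : ℝ) + 1) ^ 2 * ((n : ℝ) + 2) ^ 2) := by gcongr
  have hg := gevrey_nonneg hc (zero_le_one.trans hA) n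
  calc A * (((n : ℝ) + 1) ^ 3 * gevrey c A n)
      ≤ A * (A * (((n : ℝ) + 1) ^ 2 * ((n : ℝ) + 2) ^ 2) * gevrey c A n) := by gcongr
    _ = gevrey c A (n + 2) := by
      rw [gevrey_succ c A (n + 1), gevrey_succ]
      push_cast
      ring

lemma mul_gevrey_succ_le {c A T : ℝ} (hc : 0 ≤ c) (hA : 0 ≤ A) (hT : 1 ≤ T) (k l : ℕ) :
    T ^ l * gevrey c A (k + (l + 1)) ≤ gevrey (c * A) (4 * A * T) (k + l) := by
  have hsq : (((k + l : ℕ) : ℝ) + 1) ^ 2 ≤ 4 ^ (k + l) := by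
    have hlin : ((k + l : ℕ) : ℝ) + 1 ≤ 2 ^ (k + l) := by
      exact_mod_cast Nat.succ_le_of_lt (Nat.lt_two_pow_self (n := k + l))
    calc (((k + l : ℕ) : ℝ) + 1) ^ 2 ≤ (2 ^ (k + l)) ^ 2 := by gcongr
      _ = 4 ^ (k + l) := by rw [← pow_mul, mul_comm, pow_mul]; norm_num
  have hg := gevrey_nonneg hc hA (k + l)
  calc T ^ l * gevrey c A (k + (l + 1))
      = T ^ l * (A * (((k + l : ℕ) : ℝ) + 1) ^ 2 * gevrey c A (k + l)) := by
        rw [← add_assoc, gevrey_succ]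
    _ ≤ T ^ (k + l) * (A * 4 ^ (k + l) * gevrey c A (k + l)) := by
        gcongr
        omega
    _ = gevrey (c * A) (4 * A * T) (k + l) := by
        rw [gevrey, gevrey, mul_pow, mul_pow]
        ring

lemma pow_le_gevrey_one (hA : 0 ≤ A) (n : ℕ) : A ^ n ≤ gevrey 1 A n := by
  rw [gevrey, one_mul]
  exact le_mul_of_one_le_right (pow_nonneg hA n)
    (one_le_pow₀ (Nat.one_le_cast.2 n.factorial_pos))

lemma choose_mul_choose_mul_gevrey_le (hc : 0 ≤ c) (hd : 0 ≤ d) (hA : 0 ≤ A) (i j p r : ℕ) :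
    ((i + j).choose i * (p + r).choose p : ℝ) * (gevrey c A (i + p) * gevrey d A (j + r))
      ≤ gevrey (c * d) A (i + j + (p + r)) := by
  have hchoose : ((i + j).choose i * (p + r).choose p : ℝ) * ((i + p)! * (j + r)!)
      ≤ (i + j + (p + r))! := by
    exact_mod_cast choose_mul_choose_mul_factorial_le i j p r
  have hfact : ((i + p)! * (j + r)! : ℝ) ≤ (i + j + (p + r))! := by
    rw [add_add_add_comm]
    exact_mod_cast Nat.le_of_dvd (Nat.factorial_pos _)
      (Nat.factorial_mul_factorial_dvd_factorial_add (i + p) (j + r))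
  calc _ = c * d * A ^ (i + j + (p + r)) *
        (((i + j).choose i * (p + r).choose p : ℝ) * ((i + p)! * (j + r)!) *
          ((i + p)! * (j + r)!)) := by
        rw [gevrey, gevrey]
        ring
    _ ≤ c * d * A ^ (i + j + (p + r)) * ((i + j + (p + r))! * (i + j + (p + r))!) := by gcongr
    _ = gevrey (c * d) A (i + j + (p + r)) := by rw [gevrey, sq]

variable {F : Type*} [NormedAddCommGroup F]

lemma norm_binomSum_le {n : ℕ} {f : ℕ → ℕ → F} {M : ℝ}
    (h : ∀ i j, i + j = n → (n.choose i : ℝ) * ‖f i j‖ ≤ M) : ‖binomSum n f‖ ≤ (n + 1) * M := by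
  have hsum := norm_sum_le_of_le (Finset.HasAntidiagonal.antidiagonal n) fun p hp ↦
    norm_nsmul_le.trans (h p.1 p.2 (Finset.HasAntidiagonal.mem_antidiagonal.1 hp))
  simpa [binomSum] using hsum

lemma norm_shiftAddTwo_le (hc : 0 ≤ c) (hA : 2 ≤ A) {W : ℕ → F} {l : ℕ}
    (hW : ∀ m, ‖W m‖ ≤ gevrey c A (m + l)) (j : ℕ) :
    ‖shiftAddTwo W j‖ ≤ (j + 1) * gevrey c A (j + l) := by
  refine norm_binomSum_le fun m n hmn ↦ ?_
  subst hmn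
  have hA0 : 0 ≤ A := by linarith
  have hterm : ‖2 ^ n • W m‖ ≤ gevrey c A (m + l) * gevrey 1 A n := by
    calc ‖2 ^ n • W m‖ ≤ ((2 ^ n : ℕ) : ℝ) * ‖W m‖ := norm_nsmul_le
      _ = ‖W m‖ * 2 ^ n := by
        push_cast
        ring
      _ ≤ gevrey c A (m + l) * gevrey 1 A n := by
        gcongr
        · exact gevrey_nonneg hc hA0 _
        · exact hW m
        · exact (pow_le_pow_left₀ zero_le_two hA n).trans (pow_le_gevrey_one hA0 n)
  have hprod := choose_mul_choose_mul_gevrey_le hc zero_le_one hA0 m n l 0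
  simp only [add_zero, Nat.choose_self, Nat.cast_one, mul_one] at hprod
  exact (mul_le_mul_of_nonneg_left hterm (Nat.cast_nonneg _)).trans hprod

variable [NormedSpace ℝ F] {B : F →L[ℝ] F →L[ℝ] F}

lemma choose_mul_norm_flux_le (hc : 0 ≤ c) (hA : 2 ≤ A) {V W : ℕ → F} {p r : ℕ}
    (hV : ∀ i, ‖V i‖ ≤ gevrey c A (i + p)) (hW : ∀ j, ‖W j‖ ≤ gevrey c A (j + r)) (k : ℕ) :
    ((p + r).choose p : ℝ) * ‖flux B V W k‖
      ≤ (k + 1) ^ 2 * (‖B‖ * gevrey (c * c) A (k + (p + r))) := by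
  have hA0 : 0 ≤ A := by linarith
  have hN : (0 : ℝ) < (p + r).choose p := Nat.cast_pos.2 (Nat.choose_pos (Nat.le_add_right p r))
  rw [sq, mul_assoc, ← le_div_iff₀' hN, mul_div_assoc]
  refine norm_binomSum_le fun i j hij ↦ ?_
  rw [le_div_iff₀' hN]
  have hgi := gevrey_nonneg hc hA0 (i + p)
  have hgj := gevrey_nonneg hc hA0 (j + r)
  have hjk : (j : ℝ) + 1 ≤ k + 1 := by
    gcongr
    omega
  calc ((p + r).choose p : ℝ) * (k.choose i * ‖B (V i) (shiftAddTwo W j)‖)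
      ≤ (p + r).choose p * (k.choose i *
          (‖B‖ * gevrey c A (i + p) * ((k + 1) * gevrey c A (j + r)))) := by
        gcongr
        refine (B.le_opNorm₂ _ _).trans ?_
        gcongr
        · exact hV i
        · exact (norm_shiftAddTwo_le hc hA hW j).trans (by gcongr)
    _ = (k + 1) * (‖B‖ * ((k.choose i * (p + r).choose p : ℝ) *
          (gevrey c A (i + p) * gevrey c A (j + r)))) := by ring
    _ ≤ (k + 1) * (‖B‖ * gevrey (c * c) A (k + (p + r))) := by
        gcongr
        exact hij ▸ choose_mul_choose_mul_gevrey_le hc hc hA0 i j p r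

lemma norm_binomSum_flux_le (hc : 0 ≤ c) (hA : 2 ≤ A) {L : ℕ} {D : ℕ → ℕ → F}
    (hD : ∀ l ≤ L, ∀ m, ‖D l m‖ ≤ gevrey c A (m + l)) (k : ℕ) :
    ‖binomSum L (fun i j ↦ flux B (D i) (D j) k)‖
      ≤ (L + 1) * ((k + 1) ^ 2 * (‖B‖ * gevrey (c * c) A (k + L))) := by
  refine norm_binomSum_le fun p r hpr ↦ ?_
  subst hpr
  exact choose_mul_norm_flux_le hc hA (hD p (Nat.le_add_right p r)) (hD r (Nat.le_add_left r p)) k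

lemma norm_neg_inv_smul_sub_sub_le {u v w : F} {x t r X τ b : ℝ} (hx : |x| ≤ X) (hτ : 0 < τ)
    (hτt : τ ≤ |t|) (hr : 0 ≤ r) (hu : ‖u‖ ≤ b) (hv : ‖v‖ ≤ b) (hw : ‖w‖ ≤ b) :
    ‖-(3 * t)⁻¹ • (u - x • v - r • w)‖ ≤ (1 + X + r) / (3 * τ) * b := by
  have hX : 0 ≤ X := (abs_nonneg x).trans hx
  have hnorm : ‖u - x • v - r • w‖ ≤ b + X * b + r * b := by
    refine norm_sub_le_of_le (norm_sub_le_of_le hu ?_) ?_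
    · rw [norm_smul]
      exact mul_le_mul hx hv (norm_nonneg v) hX
    · rw [norm_smul, Real.norm_of_nonneg hr]
      gcongr
  calc ‖-(3 * t)⁻¹ • (u - x • v - r • w)‖ = ‖u - x • v - r • w‖ / (3 * |t|) := by
        rw [norm_smul, norm_neg, norm_inv, norm_mul, Real.norm_ofNat, Real.norm_eq_abs,
          inv_mul_eq_div]
    _ ≤ (b + X * b + r * b) / (3 * τ) := by
        have hb : 0 ≤ b := (norm_nonneg u).trans hu
        gcongr
    _ = (1 + X + r) / (3 * τ) * b := by ring

lemma gevrey_recursion_le {β X τ : ℝ} (hc : 0 ≤ c) (hA : 1 ≤ A) (hβ : 0 ≤ β) (hX : 0 ≤ X)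
    (hτ : 0 < τ) (hAc : (1 + X) / (3 * τ) + β * c ≤ A) (k l : ℕ) :
    (1 + X + l) / (3 * τ) * gevrey c A (k + l + 1)
        + ((l + 1 : ℕ) + 1) * ((k + 1) ^ 2 * (β * gevrey (c * c) A (k + (l + 1))))
      ≤ gevrey c A (k + (l + 3)) := by
  have hk : (0 : ℝ) ≤ k := k.cast_nonneg
  have hl : (0 : ℝ) ≤ l := l.cast_nonneg
  set b : ℝ := gevrey c A (k + l + 1)
  have hb : 0 ≤ b := gevrey_nonneg hc (by linarith) _
  have hb_mul : gevrey (c * c) A (k + (l + 1)) = c * b := by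
    simp only [b, gevrey, add_assoc, mul_assoc]
  set K : ℝ := ((k + l + 1 : ℕ) : ℝ) + 1
  have hK : K = k + l + 2 := by
    simp only [K]
    push_cast
    ring
  have hK_lin : 1 + X + l ≤ (1 + X) * K ^ 3 :=
    calc 1 + X + l ≤ (1 + X) * (1 + l) := by nlinarith [hl]
      _ ≤ (1 + X) * K := by
        gcongr
        linarith [hk]
      _ ≤ (1 + X) * K ^ 3 := by
        gcongr
        exact le_self_pow₀ (by linarith) three_ne_zero
  have hK_quad : ((l + 1 : ℕ) + 1 : ℝ) * (k + 1) ^ 2 ≤ K ^ 3 :=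
    calc _ ≤ K * K ^ 2 := by
          gcongr <;> push_cast <;> linarith
      _ = K ^ 3 := by ring
  calc _ = (1 + X + l) / (3 * τ) * b + β * c * (((l + 1 : ℕ) + 1) * (k + 1) ^ 2 * b) := by
        rw [hb_mul]
        ring
    _ ≤ (1 + X) * K ^ 3 / (3 * τ) * b + β * c * (K ^ 3 * b) := by gcongr
    _ = ((1 + X) / (3 * τ) + β * c) * (K ^ 3 * b) := by ring
    _ ≤ A * (K ^ 3 * b) := by gcongr
    _ ≤ gevrey c A (k + (l + 3)) := mul_pow_three_mul_gevrey_le hc hA (k + l + 1)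

lemma norm_jet_add_three_le {V : ℕ → Plane → F} {z : Plane} {X τ : ℝ} (hc : 0 ≤ c)
    (hA : 2 ≤ A) (hX : |z 0| ≤ X) (hτ : 0 < τ) (hτz : τ ≤ |z 1|)
    (hAc : (1 + X) / (3 * τ) + ‖B‖ * c ≤ A) {l : ℕ}
    (h : ∀ i ≤ l + 1, ∀ k, ‖jet B V i k z‖ ≤ gevrey c A (k + i)) (k : ℕ) :
    ‖jet B V (l + 3) k z‖ ≤ gevrey c A (k + (l + 3)) := by
  have hA_one : 1 ≤ A := one_le_two.trans hA
  have hlin := norm_neg_inv_smul_sub_sub_le hX hτ hτz l.cast_nonneg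
    (by simpa only [add_assoc, add_comm 1] using h l (by omega) (k + 1)) (h (l + 1) le_rfl k)
    ((h l (by omega) k).trans (gevrey_le_succ hc hA_one _))
  rw [jet_add_three]
  exact (norm_sub_le_of_le hlin (norm_binomSum_flux_le hc hA h k)).trans
    (gevrey_recursion_le hc hA_one (norm_nonneg B) ((abs_nonneg _).trans hX) hτ hAc k l)

lemma norm_jet_le {V : ℕ → Plane → F} {z : Plane} {X τ : ℝ} (hc : 0 ≤ c) (hA : 2 ≤ A)
    (hX : |z 0| ≤ X) (hτ : 0 < τ) (hτz : τ ≤ |z 1|) (hAc : (1 + X) / (3 * τ) + ‖B‖ * c ≤ A)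
    (hbase : ∀ l ≤ 2, ∀ k, ‖jet B V l k z‖ ≤ gevrey c A (k + l)) (l k : ℕ) :
    ‖jet B V l k z‖ ≤ gevrey c A (k + l) := by
  induction l using Nat.strong_induction_on generalizing k with
  | _ l ih =>
    match l with
    | 0 | 1 | 2 => exact hbase _ (by norm_num) k
    | l + 3 => exact norm_jet_add_three_le hc hA hX hτ hτz hAc (fun i hi m ↦ ih i (by omega) m) k

end Gevrey

section SliceNorm

lemma HasWeakDerivOn.of_hasDerivAt {J : Set ℝ} (hJ : IsOpen J) {f g : ℝ → ℂ}
    (hg : ContinuousOn g J) (h : ∀ x ∈ J, HasDerivAt f (g x) x) : HasWeakDerivOn J f g := by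
  have hf : ContinuousOn f J := fun x hx ↦ (h x hx).continuousAt.continuousWithinAt
  have hf_loc := hf.locallyIntegrableOn hJ.measurableSet (μ := volume)
  have hg_loc := hg.locallyIntegrableOn hJ.measurableSet (μ := volume)
  refine ⟨hf_loc, hg_loc, fun η hη hηc hηJ ↦ ?_⟩
  have hη' : Continuous (deriv η) := hη.continuous_deriv (by norm_cast)
  have hparts := integral_bilinear_hasLineDerivAt_right_eq_neg_left_of_integrable (μ := volume)
    (f := η) (f' := deriv η) (g := f) (g' := g) (v := (1 : ℝ)) (B := ContinuousLinearMap.lsmul ℝ ℝ)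
    (integrable_smul_of_tsupport_subset hη' hηc.deriv (tsupport_deriv_subset.trans hηJ) hf_loc)
    (integrable_smul_of_tsupport_subset hη.continuous hηc hηJ hg_loc)
    (integrable_smul_of_tsupport_subset hη.continuous hηc hηJ hf_loc)
    (fun x _ ↦ by
      simpa using (hη.differentiable (by simp) x).hasDerivAt.hasFDerivAt.hasLineDerivAt 1)
    (fun x hx ↦ by simpa using (h x (hηJ hx)).hasFDerivAt.hasLineDerivAt 1)
  simp only [ContinuousLinearMap.lsmul_apply, Complex.real_smul] at hparts
  rw [hparts, neg_neg]

lemma h1Norm_le {J : Set ℝ} (hJ : IsOpen J) {f g : ℝ → ℂ} {M : ℝ} (hg : ContinuousOn g J)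
    (h : ∀ x ∈ J, HasDerivAt f (g x) x) (hfM : ∀ x ∈ J, ‖f x‖ ≤ M) (hgM : ∀ x ∈ J, ‖g x‖ ≤ M) :
    h1Norm J f ≤ 2 * (volume J ^ (1 / 2 : ℝ) * ENNReal.ofReal M) := by
  have hbound {F : ℝ → ℂ} (hF : ∀ x ∈ J, ‖F x‖ ≤ M) :
      eLpNorm F 2 (volume.restrict J) ≤ volume J ^ (1 / 2 : ℝ) * ENNReal.ofReal M := by
    simpa using eLpNorm_le_of_ae_bound (p := 2) (ae_restrict_of_forall_mem hJ.measurableSet hF)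
  have hadd (p q : ℝ≥0∞) : (p ^ 2 + q ^ 2) ^ (1 / 2 : ℝ) ≤ p + q := by
    rw [one_div, ENNReal.rpow_inv_le_iff two_pos, ENNReal.rpow_two, add_sq']
    exact le_self_add
  calc h1Norm J f ≤ _ := iInf₂_le g (HasWeakDerivOn.of_hasDerivAt hJ hg h)
    _ ≤ eLpNorm f 2 (volume.restrict J) + eLpNorm g 2 (volume.restrict J) := hadd _ _
    _ ≤ _ := (add_le_add (hbound hfM) (hbound hgM)).trans_eq (two_mul _).symm

lemma abs_cbrt_le (t : ℝ) : |cbrt t| ≤ 1 + |t| := by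
  have hsign : |Real.sign t| ≤ 1 := by
    rcases Real.sign_apply_eq t with h | h | h <;> rw [h] <;> norm_num
  have hone : 1 ≤ 1 + |t| := le_add_of_nonneg_right (abs_nonneg t)
  rw [cbrt, abs_mul, abs_of_nonneg (Real.rpow_nonneg (abs_nonneg t) _)]
  calc |Real.sign t| * |t| ^ (1 / 3 : ℝ) ≤ 1 * (1 + |t|) ^ (1 / 3 : ℝ) := by
        gcongr
        exact le_add_of_nonneg_left zero_le_one
    _ ≤ 1 + |t| := by
        rw [one_mul]
        exact Real.rpow_le_self_of_one_le hone (by norm_num)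

variable {x₀ t₀ ε : ℝ}

lemma abs_sub_le_abs_of_mem_closedSquare {z : Plane} (hz : z ∈ closedSquare x₀ t₀ ε) :
    |t₀| - ε ≤ |z 1| := by
  have hdist : |t₀ - z 1| ≤ ε := abs_le.2 ⟨by linarith [hz.2.2], by linarith [hz.2.1]⟩
  linarith [abs_sub_abs_le_abs_sub t₀ (z 1)]

lemma hasDerivAt_slice {G H : Plane → ℂ} (hε : 0 < ε)
    (hG : ContinuousOn G (closedSquare x₀ t₀ ε)) (hH : ContinuousOn H (closedSquare x₀ t₀ ε))
    (hGH : ∀ z ∈ square x₀ t₀ ε, HasLineDerivAt ℝ G (H z) z ex) {t x : ℝ}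
    (ht : t ∈ Set.Icc (t₀ - ε) (t₀ + ε)) (hx : x ∈ Set.Ioo (x₀ - ε) (x₀ + ε)) :
    HasDerivAt (fun y ↦ G !₂[y, t]) (H !₂[x, t]) x := by
  let I := Set.Ioo (t₀ - ε) (t₀ + ε)
  let J := Set.Ioo (x₀ - ε) (x₀ + ε)
  have hline (y s : ℝ) : (!₂[y, s] : Plane) = !₂[0, s] + y • ex := by
    ext i
    fin_cases i <;> simp
  have hcont : Continuous fun p : ℝ × ℝ ↦ (!₂[p.2, p.1] : Plane) := by fun_prop
  have hmaps : Set.MapsTo (fun p : ℝ × ℝ ↦ (!₂[p.2, p.1] : Plane))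
      (Set.Icc (t₀ - ε) (t₀ + ε) ×ˢ J) (closedSquare x₀ t₀ ε) := fun p hp ↦
    ⟨Set.Ioo_subset_Icc_self hp.2, hp.1⟩
  have hG' := hG.comp hcont.continuousOn hmaps
  have hH' := hH.comp hcont.continuousOn hmaps
  have hfilter (y : ℝ) (hy : y ∈ J) :
      nhdsWithin t I ×ˢ nhds y ≤ nhdsWithin (t, y) (Set.Icc (t₀ - ε) (t₀ + ε) ×ˢ J) := by
    rw [nhdsWithin_prod_eq, isOpen_Ioo.nhdsWithin_eq hy]
    exact Filter.prod_mono_left _ (nhdsWithin_mono t Set.Ioo_subset_Icc_self)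
  have : (nhdsWithin t I).NeBot := by
    rw [← mem_closure_iff_nhdsWithin_neBot, closure_Ioo (by linarith)]
    exact ht
  refine hasDerivAt_of_tendsto_of_tendsto_prod (l := nhdsWithin t I)
    (f := fun s y ↦ G !₂[y, s]) (f' := fun s y ↦ H !₂[y, s]) (g' := fun y ↦ H !₂[y, t])
    isOpen_Ioo ?_ ?_ (fun y hy ↦ ?_) (fun y hy ↦ ?_) hx
  · exact hH'.comp (by fun_prop : Continuous fun y : ℝ ↦ (t, y)).continuousOn fun y hy ↦ ⟨ht, hy⟩
  · filter_upwards [self_mem_nhdsWithin] with s hs y hy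
    have hderiv := hGH !₂[y, s] ⟨hy, hs⟩
    rw [hline y s] at hderiv
    simpa only [← hline] using hasLineDerivAt_add_smul_iff.1 hderiv
  · exact ((hG' (t, y) ⟨ht, hy⟩).mono_left (hfilter y hy)).comp
      (Filter.tendsto_id.prodMk tendsto_const_nhds)
  · exact (hH' (t, y) ⟨ht, hy⟩).mono_left (hfilter y hy)

lemma pointwiseBound_of_norm_le {G H : Plane → ℂ} {l : ℕ} {w : 𝓢'(Plane, ℂ)} {M : ℝ} (hε : 0 < ε)
    (hG : ContinuousOn G (closedSquare x₀ t₀ ε)) (hH : ContinuousOn H (closedSquare x₀ t₀ ε))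
    (hGH : ∀ z ∈ square x₀ t₀ ε, HasLineDerivAt ℝ G (H z) z ex)
    (hw : IsGivenBy (square x₀ t₀ ε) (dxPow l w) G)
    (hGM : ∀ z ∈ closedSquare x₀ t₀ ε, ‖G z‖ ≤ M) (hHM : ∀ z ∈ closedSquare x₀ t₀ ε, ‖H z‖ ≤ M) :
    PointwiseBound x₀ t₀ ε l w (2 * (2 * ε) ^ (1 / 2 : ℝ) * ((1 + |t₀| + ε) ^ l * M)) := by
  refine ⟨G, hG, hw, iSup₂_le fun t ht ↦ ?_⟩
  have hcbrt : |cbrt t| ≤ 1 + |t₀| + ε := by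
    have hdist : |t - t₀| ≤ ε := abs_le.2 ⟨by linarith [ht.1], by linarith [ht.2]⟩
    linarith [abs_cbrt_le t, abs_sub_abs_le_abs_sub t t₀]
  have hmem (x : ℝ) (hx : x ∈ Set.Ioo (x₀ - ε) (x₀ + ε)) : !₂[x, t] ∈ closedSquare x₀ t₀ ε :=
    ⟨Set.Ioo_subset_Icc_self hx, ht⟩
  have hle {f : Plane → ℂ} (hf : ∀ z ∈ closedSquare x₀ t₀ ε, ‖f z‖ ≤ M) (x : ℝ)
      (hx : x ∈ Set.Ioo (x₀ - ε) (x₀ + ε)) :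
      ‖((cbrt t : ℝ) : ℂ) ^ l * f !₂[x, t]‖ ≤ (1 + |t₀| + ε) ^ l * M := by
    have hfx := hf _ (hmem x hx)
    rw [norm_mul, norm_pow, Complex.norm_real, Real.norm_eq_abs]
    gcongr
  have hslice : Continuous fun x : ℝ ↦ (!₂[x, t] : Plane) := by fun_prop
  refine (h1Norm_le isOpen_Ioo (continuousOn_const.mul (hH.comp hslice.continuousOn hmem))
    (fun x hx ↦ (hasDerivAt_slice hε hG hH hGH ht hx).const_mul _) (hle hGM) (hle hHM)).trans_eq ?_
  rw [Real.volume_Ioo, show x₀ + ε - (x₀ - ε) = 2 * ε by ring,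
    ENNReal.ofReal_rpow_of_nonneg (by positivity) (by norm_num),
    ← ENNReal.ofReal_mul (by positivity), ← ENNReal.ofReal_ofNat, ← ENNReal.ofReal_mul zero_le_two,
    mul_assoc]

end SliceNorm

section System

variable {ι : Type*} [Fintype ι] {B : (ι → ℂ) →L[ℝ] (ι → ℂ) →L[ℝ] (ι → ℂ)} {U : Set Plane}
  {w : ι → 𝓢'(Plane, ℂ)} {V : ℕ → Plane → ι → ℂ} {x₀ t₀ ε : ℝ}

lemma jet_eq_iteratedFDeriv {k : ℕ} (hV : ContDiff ℝ 2 (V k)) {l : ℕ} (hl : l ≤ 2) (z : Plane) :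
    jet B V l k z = iteratedFDeriv ℝ l (V k) z fun _ ↦ ex := by
  interval_cases l
  · rw [jet_zero, iteratedFDeriv_zero_apply]
  · rw [jet_one, iteratedFDeriv_one_apply]
  · have hd : DifferentiableAt ℝ (fderiv ℝ (V k)) z :=
      (hV.fderiv_right (m := 1) (by norm_num)).differentiable one_ne_zero z
    rw [jet_two, iteratedFDeriv_two_apply]
    beta_reduce
    rw [fderiv_clm_apply hd (by fun_prop)]
    simp

lemma norm_jet_le_of_norm_iteratedFDeriv_le {k : ℕ} (hV : ContDiff ℝ 2 (V k)) {l : ℕ} (hl : l ≤ 2)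
    {z : Plane} {M : ℝ} (hM : 0 ≤ M) (h : ∀ α, ‖iteratedFDeriv ℝ l (V k · α) z‖ ≤ M) :
    ‖jet B V l k z‖ ≤ M := by
  rw [jet_eq_iteratedFDeriv hV hl]
  refine (pi_norm_le_iff_of_nonneg hM).2 fun α ↦ ?_
  have hcomp := (ContinuousLinearMap.proj α : (ι → ℂ) →L[ℝ] ℂ).iteratedFDeriv_comp_left
    (hV.contDiffAt (x := z)) (i := l) (by exact_mod_cast hl)
  calc ‖iteratedFDeriv ℝ l (V k) z (fun _ ↦ ex) α‖
      = ‖iteratedFDeriv ℝ l (V k · α) z fun _ ↦ ex‖ := by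
        exact congrArg norm (congrFun (congrArg DFunLike.coe hcomp) fun _ ↦ ex).symm
    _ ≤ ‖iteratedFDeriv ℝ l (V k · α) z‖ := by
        simpa [ex] using (iteratedFDeriv ℝ l (V k · α) z).le_opNorm fun _ ↦ ex
    _ ≤ M := h α

lemma norm_jet_le_gevrey (hV : ∀ k, ContDiff ℝ 2 (V k)) {c A : ℝ} {a : ι → ℝ} (hc : 0 ≤ c)
    (ha : ∀ α, 0 ≤ a α) (haA : ∀ α, a α ≤ A) (hA : 1 ≤ A) {z : Plane}
    (h : ∀ k α, ∀ n ≤ 2, ‖iteratedFDeriv ℝ n (V k · α) z‖ ≤ gevrey c (a α) k) {l : ℕ} (hl : l ≤ 2)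
    (k : ℕ) : ‖jet B V l k z‖ ≤ gevrey c A (k + l) := by
  have hA_nonneg := zero_le_one.trans hA
  refine norm_jet_le_of_norm_iteratedFDeriv_le (hV k) hl (gevrey_nonneg hc hA_nonneg _) fun α ↦ ?_
  calc ‖iteratedFDeriv ℝ l (V k · α) z‖ ≤ gevrey c (a α) k := h k α l hl
    _ ≤ gevrey c A k := by
        rw [gevrey, gevrey]
        have := ha α
        gcongr
        exact haA α
    _ ≤ gevrey c A (k + l) :=
        monotone_nat_of_le_succ (gevrey_le_succ hc hA) (Nat.le_add_right k l)

lemma IsSolutionFamily.pointwiseBound (h : IsSolutionFamily (square x₀ t₀ ε) B w V) (hε : 0 < ε)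
    (hεt : ε < |t₀|) {c A : ℝ} (hc : 0 ≤ c) (hA : 2 ≤ A)
    (hAc : (1 + (|x₀| + ε)) / (3 * (|t₀| - ε)) + ‖B‖ * c ≤ A)
    (hbase : ∀ z, ∀ l ≤ 2, ∀ k, ‖jet B V l k z‖ ≤ gevrey c A (k + l)) (α : ι) (k l : ℕ) :
    PointwiseBound x₀ t₀ ε l (P^[k] (w α)) (2 * (2 * ε) ^ (1 / 2 : ℝ) *
      gevrey (c * A) (4 * A * (1 + |t₀| + ε)) (k + l)) := by
  have hU := isOpen_square x₀ t₀ ε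
  have hsub : square x₀ t₀ ε ⊆ closedSquare x₀ t₀ ε := fun z hz ↦
    ⟨Set.Ioo_subset_Icc_self hz.1, Set.Ioo_subset_Icc_self hz.2⟩
  have hτ (z : Plane) (hz : z ∈ closedSquare x₀ t₀ ε) : z 1 ≠ 0 :=
    abs_pos.1 ((sub_pos.2 hεt).trans_le (abs_sub_le_abs_of_mem_closedSquare hz))
  have hcont (l : ℕ) : ContinuousOn (jet B V l k · α) (closedSquare x₀ t₀ ε) :=
    (continuous_apply α).comp_continuousOn ((continuousOn_jet h.contDiff l k).mono hτ)
  have hjet (l : ℕ) (z : Plane) (hz : z ∈ closedSquare x₀ t₀ ε) :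
      ‖jet B V l k z α‖ ≤ gevrey c A (k + l) := by
    have hX : |z 0| ≤ |x₀| + ε := abs_le.2
      ⟨by linarith [hz.1.1, neg_abs_le x₀], by linarith [hz.1.2, le_abs_self x₀]⟩
    exact (norm_le_pi_norm _ α).trans (norm_jet_le hc hA hX (sub_pos.2 hεt)
      (abs_sub_le_abs_of_mem_closedSquare hz) hAc (hbase z) l k)
  obtain ⟨W, hW, hWw, hWM⟩ := pointwiseBound_of_norm_le hε (hcont l) (hcont (l + 1))
    (fun z hz ↦ hasDerivAt_pi.1 (h.hasLineDerivAt_jet hU (fun z hz ↦ hτ z (hsub hz)) l k hz) α)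
    (h.isGivenBy_jet hU (fun z hz ↦ hτ z (hsub hz)) l k α)
    (fun z hz ↦ (hjet l z hz).trans (gevrey_le_succ hc (by linarith) _)) (hjet (l + 1))
  refine ⟨W, hW, hWw, hWM.trans (ENNReal.ofReal_le_ofReal ?_)⟩
  gcongr
  exact mul_gevrey_succ_le hc (by linarith) (by linarith [abs_nonneg t₀]) k l

lemma exists_contDiff_family_of_sobolevNorm_le {s : ℝ} (hs : 3 < s) :
    ∃ K : ℝ, 0 < K ∧ ∀ {ψ : Plane → ℝ}, (fun z ↦ ((ψ z : ℝ) : ℂ)).HasTemperateGrowth →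
      (∀ z ∈ U, ψ z = 1) → ∀ (w : ι → 𝓢'(Plane, ℂ)) (M : ℕ → ι → ℝ), (∀ k α, 0 < M k α) →
      (∀ k α, sobolevNorm s (cutoff ψ (P^[k] (w α))) ≤ ENNReal.ofReal (M k α)) →
      ∃ V : ℕ → Plane → ι → ℂ, (∀ k, ContDiff ℝ 2 (V k)) ∧
        (∀ k α, IsGivenBy U (P^[k] (w α)) (V k · α)) ∧
        ∀ k α, ∀ n ≤ 2, ∀ z, ‖iteratedFDeriv ℝ n (V k · α) z‖ ≤ K * M k α := by
  obtain ⟨K, hK, embed⟩ := exists_contDiff_of_sobolevNorm_le (m := 2) (s := s) (by norm_num [hs])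
  refine ⟨K, hK, fun hψ hψ1 w M hM hw ↦ ?_⟩
  choose F hF hwF hFM using fun k α ↦ embed _ (M k α) (hM k α) (hw k α)
  exact ⟨fun k z α ↦ F k α z, fun k ↦ contDiff_pi.2 (hF k),
    fun k α ↦ ((hwF k α).mono U.subset_univ).of_cutoff hψ hψ1, hFM⟩

/-- On `U`, the distributions `w α` are locally square integrable functions which satisfy
`wₜ + wₓₓₓ + ∂ₓ (B(w, w)) = 0` against test functions. -/
def IsQuadraticSolutionOn (B : (ι → ℂ) →L[ℝ] (ι → ℂ) →L[ℝ] (ι → ℂ)) (U : Set Plane)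
    (w : ι → 𝓢'(Plane, ℂ)) : Prop :=
  ∃ f : Plane → ι → ℂ, (∀ α, LocallyL2On U (f · α)) ∧ (∀ α, IsGivenBy U (w α) (f · α)) ∧
    ∀ α (η : 𝓢(Plane, ℂ)), IsTestOn U η → airy (w α) η = ∫ z, (∂_{ex} η) z * B (f z) (f z) α

lemma IsQuadraticSolutionOn.isSolutionFamily (h : IsQuadraticSolutionOn B U w) (hU : IsOpen U)
    (hV : ∀ k, ContDiff ℝ 2 (V k)) (hw : ∀ k α, IsGivenBy U (P^[k] (w α)) (V k · α)) :
    IsSolutionFamily U B w V := by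
  obtain ⟨f, -, hf, hairy⟩ := h
  have hfV : ∀ᵐ z, z ∈ U → f z = V 0 z := by
    filter_upwards [ae_all_iff.2 fun α ↦ (hf α).ae_eq (hw 0 α) hU] with z hz hzU
    exact funext fun α ↦ hz α hzU
  have hB : ContDiff ℝ 1 fun z ↦ B (V 0 z) (V 0 z) :=
    ((B.contDiff.comp (hV 0)).clm_apply (hV 0)).of_le (by norm_num)
  refine ⟨hV, hw, fun α ↦ ?_⟩
  have hBα : ContDiff ℝ 1 fun z ↦ B (V 0 z) (V 0 z) α := contDiff_pi.1 hB α
  have hderiv (z : Plane) : HasLineDerivAt ℝ (fun z ↦ B (V 0 z) (V 0 z) α)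
      (fderiv ℝ (fun z ↦ B (V 0 z) (V 0 z)) z ex α) z ex := by
    rw [← fderiv_eval hB]
    exact (hBα.differentiable one_ne_zero z).hasFDerivAt.hasLineDerivAt ex
  have hcont : Continuous fun z ↦ fderiv ℝ (fun z ↦ B (V 0 z) (V 0 z)) z ex α :=
    (continuous_apply α).comp ((hB.continuous_fderiv one_ne_zero).clm_apply continuous_const)
  refine ⟨hcont.neg.locallyIntegrable.locallyIntegrableOn U, fun η hη ↦ ?_⟩
  calc airy (w α) η = ∫ z, (∂_{ex} η) z * B (f z) (f z) α := hairy α η hη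
    _ = ∫ z, (∂_{ex} η) z * B (V 0 z) (V 0 z) α := by
        refine integral_congr_ae ?_
        filter_upwards [hfV] with z hz
        by_cases hzU : z ∈ U
        · rw [hz hzU]
        · rw [(hη.lineDeriv ex).apply_eq_zero hzU, zero_mul, zero_mul]
    _ = ∫ z, η z * -fderiv ℝ (fun z ↦ B (V 0 z) (V 0 z)) z ex α := by
        rw [hη.integral_lineDeriv_mul hU hBα.continuous.continuousOn hcont.continuousOn
          fun z _ ↦ hderiv z, ← integral_neg]
        simp only [mul_neg]

end System

/-- The bilinear form `B` on `ℂ²` for which `∂ₓ (B((u, v), (u, v)))` consists of the nonlinear terms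
`a u uₓ + b v vₓ + c (u v)ₓ` and `a' u uₓ + b' v vₓ + c' (u v)ₓ` of the system. -/
noncomputable def coupling (a b c a' b' c' : ℝ) :
    (Fin 2 → ℂ) →L[ℝ] (Fin 2 → ℂ) →L[ℝ] (Fin 2 → ℂ) :=
  (LinearMap.mk₂ ℝ (fun x y ↦
    ![(a : ℂ) / 2 * (x 0 * y 0) + (b : ℂ) / 2 * (x 1 * y 1) + (c : ℂ) * (x 0 * y 1),
      (a' : ℂ) / 2 * (x 0 * y 0) + (b' : ℂ) / 2 * (x 1 * y 1) + (c' : ℂ) * (x 0 * y 1)])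
    (fun x x' y ↦ by ext i; fin_cases i <;> simp <;> ring)
    (fun r x y ↦ by ext i; fin_cases i <;> simp <;> ring)
    (fun x y y' ↦ by ext i; fin_cases i <;> simp <;> ring)
    (fun r x y ↦ by ext i; fin_cases i <;> simp <;> ring)).toContinuousBilinearMap

lemma IsSolutionOn.isQuadraticSolutionOn {a b c a' b' c' : ℝ} {U : Set Plane} {u v : 𝓢'(Plane, ℂ)}
    (h : IsSolutionOn a b c a' b' c' U u v) :
    IsQuadraticSolutionOn (coupling a b c a' b' c') U ![u, v] := by
  obtain ⟨f, g, hf, hg, huf, hvg, hu, hv⟩ := h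
  refine ⟨fun z ↦ ![f z, g z], Fin.forall_fin_two.2 ⟨hf, hg⟩, Fin.forall_fin_two.2 ⟨huf, hvg⟩,
    Fin.forall_fin_two.2 ⟨fun η hη ↦ (hu η hη).trans ?_, fun η hη ↦ (hv η hη).trans ?_⟩⟩
  all_goals
    simp only [coupling, LinearMap.toContinuousBilinearMap_apply, LinearMap.mk₂_apply, sq,
      mul_comm ((∂_{ex} η) _), Matrix.cons_val_zero, Matrix.cons_val_one]

lemma hasTemperateGrowth_ofReal {ψ : Plane → ℝ} (hψ : ContDiff ℝ ∞ ψ)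
    (hψc : HasCompactSupport ψ) : (fun z ↦ ((ψ z : ℝ) : ℂ)).HasTemperateGrowth :=
  ((hψc.comp_left Complex.ofReal_zero).toSchwartzMap
    (Complex.ofRealCLM.contDiff.comp hψ)).hasTemperateGrowth

end KdVSystem

open KdVSystem in
theorem proposition4p3_general {ι : Type*} [Finite ι]
    (B : (ι → ℂ) →L[ℝ] (ι → ℂ) →L[ℝ] (ι → ℂ)) (x₀ t₀ ε : ℝ) (hε : 0 < ε) (hεt : ε < |t₀|)
    (ψ : Plane → ℝ) (hψ : (fun z ↦ ((ψ z : ℝ) : ℂ)).HasTemperateGrowth)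
    (hψ1 : ∀ z ∈ square x₀ t₀ ε, ψ z = 1) (s : ℝ) (hs : 3 < s) (C : ℝ) (A : ι → ℝ) (hC : 0 < C)
    (hA : ∀ α, 0 < A α) :
    ∃ c₁ A' : ℝ, 0 < c₁ ∧ 0 < A' ∧ ∀ w : ι → 𝓢'(Plane, ℂ),
      IsQuadraticSolutionOn B (square x₀ t₀ ε) w →
      (∀ k α, sobolevNorm s (cutoff ψ (P^[k] (w α)))
        ≤ ENNReal.ofReal (C * A α ^ k * (k ! : ℝ) ^ 2)) →
      ∀ α k l, PointwiseBound x₀ t₀ ε l (P^[k] (w α))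
        (c₁ * A' ^ (k + l) * ((k + l)! : ℝ) ^ 2) := by
  have := Fintype.ofFinite ι
  obtain ⟨K, hK, embed⟩ := exists_contDiff_family_of_sobolevNorm_le (U := square x₀ t₀ ε)
    (ι := ι) hs
  have hA_sum (α : ι) : A α ≤ ∑ β, A β :=
    Finset.single_le_sum (fun β _ ↦ (hA β).le) (Finset.mem_univ α)
  have hA_nonneg : 0 ≤ ∑ β, A β := Finset.sum_nonneg fun β _ ↦ (hA β).le
  have hrec_nonneg : 0 ≤ (1 + (|x₀| + ε)) / (3 * (|t₀| - ε)) + ‖B‖ * (K * C) := by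
    have := sub_pos.2 hεt
    positivity
  set A' := 2 + ∑ β, A β + ((1 + (|x₀| + ε)) / (3 * (|t₀| - ε)) + ‖B‖ * (K * C))
  refine ⟨2 * (2 * ε) ^ (1 / 2 : ℝ) * (K * C * A'), 4 * A' * (1 + |t₀| + ε), by positivity,
    by positivity, fun w hw hsob α k l ↦ ?_⟩
  obtain ⟨V, hV, hwV, hVM⟩ := embed hψ hψ1 w (fun k α ↦ C * A α ^ k * (k ! : ℝ) ^ 2)
    (fun k α ↦ by have := hA α; positivity) hsob
  have hfam := hw.isSolutionFamily (isOpen_square x₀ t₀ ε) hV hwV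
  have hjet := hfam.pointwiseBound hε hεt (c := K * C) (A := A') (by positivity) (by linarith)
    (by linarith) (fun z l hl k ↦ norm_jet_le_gevrey hV (by positivity) (fun α ↦ (hA α).le)
      (fun α ↦ by linarith [hA_sum α]) (by linarith) (fun k α n hn ↦ ?_) hl k) α k l
  · simpa only [gevrey, mul_assoc] using hjet
  · simpa only [gevrey, mul_assoc] using hVM k α n hn z

theorem proposition4p3
    -- the coefficients of the system
    (a b c a' b' c' : ℝ)
    -- the point, the size of the square, and the cut-off function
    (x₀ t₀ ε : ℝ) (hε : 0 < ε) (hεt : ε < |t₀|)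
    (ψ : KdVSystem.Plane → ℝ) (hψ : ContDiff ℝ ∞ ψ) (hψc : HasCompactSupport ψ)
    (hψ1 : ∀ z ∈ KdVSystem.square x₀ t₀ ε, ψ z = 1)
    -- the constants of the assumed bounds
    (C A₁ A₂ : ℝ) (hC : 0 < C) (hA₁ : 0 < A₁) (hA₂ : 0 < A₂) :
    ∃ c₁ A₃ A₄ : ℝ, 0 < c₁ ∧ 0 < A₃ ∧ 0 < A₄ ∧
      ∀ u v : 𝓢'(KdVSystem.Plane, ℂ),
        KdVSystem.IsSolutionOn a b c a' b' c' (KdVSystem.square x₀ t₀ ε) u v →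
        (∀ k : ℕ, KdVSystem.sobolevNorm (7 / 2) (KdVSystem.cutoff ψ (KdVSystem.P^[k] u))
          ≤ ENNReal.ofReal (C * A₁ ^ k * (k ! : ℝ) ^ 2)) →
        (∀ k : ℕ, KdVSystem.sobolevNorm (7 / 2) (KdVSystem.cutoff ψ (KdVSystem.P^[k] v))
          ≤ ENNReal.ofReal (C * A₂ ^ k * (k ! : ℝ) ^ 2)) →
        (∀ k l : ℕ, KdVSystem.PointwiseBound x₀ t₀ ε l (KdVSystem.P^[k] u)
          (c₁ * A₃ ^ (k + l) * ((k + l)! : ℝ) ^ 2)) ∧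
        (∀ k l : ℕ, KdVSystem.PointwiseBound x₀ t₀ ε l (KdVSystem.P^[k] v)
          (c₁ * A₄ ^ (k + l) * ((k + l)! : ℝ) ^ 2)) := by
  obtain ⟨c₁, A, hc₁, hA, bound⟩ := proposition4p3_general
    (KdVSystem.coupling a b c a' b' c') x₀ t₀ ε hε hεt ψ
    (KdVSystem.hasTemperateGrowth_ofReal hψ hψc) hψ1 (7 / 2) (by norm_num) C ![A₁, A₂] hC
    (Fin.forall_fin_two.2 ⟨hA₁, hA₂⟩)
  exact ⟨c₁, A, A, hc₁, hA, hA, fun u v huv hu hv ↦ Fin.forall_fin_two.1 <|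
    bound ![u, v] huv.isQuadraticSolutionOn fun k ↦ Fin.forall_fin_two.2 ⟨hu k, hv k⟩⟩
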